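/- **Definitions.** For a standard Borel space $X$ let $GX$ be the set of probability measures on $X$, with the smallest $\sigma$-algebra making all evaluations $\mu\mapsto\mu(U)$ ($U\subseteq X$ measurable) measurable; $GX$ is again standard Borel, and $G$ is an endofunctor, by push-forward, of the category $\mathbf{Sbs}$ of standard Borel spaces and measurable maps. An *element-free distribution* is a function $\varphi:(0,1]\to\mathbb N$ with countable support and total weight $\mathrm{tt}(\varphi)=\sum_{r}\varphi(r)\,r\le 1$. The set $\nabla$ of these carries the $\sigma$-algebra generated by the sets $\{\varphi : \sum_{r\in U}\varphi(r)=k\}$, for $U\subseteq(0,1]$ Borel and $k\in\mathbb N$. For $\mu\in GX$, the *multiplicity count* $\mathrm{mc}(\mu)\in\nabla$ is $r\mapsto\#\{x\in X : \mu\{x\}=r\}$. For $\mu\in GX$ and $\varphi\in\nabla$, let $\mathrm{base}_X(\mu,\varphi)\in GGX$ be the law of the random probability measure $$(1-\mathrm{tt}(\varphi))\,\mu+\sum_{r}r\sum_{i=1}^{\varphi(r)}\delta_{x^r_i},$$ where the points $x^r_i$ ($r\in(0,1]$, $1\le i\le\varphi(r)$) are independent with law $\mu$. For $\omega\in G\nabla$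 and $\mu\in GX$, put $(\omega\gg\!=\mathrm{base}_X)(\mu)=\int_\nabla \mathrm{base}_X(\mu,\varphi)\,\omega(\mathrm d\varphi)\in GGX$. Let $\mathrm{Nat}(G,GG)$ be the set of natural transformations $G\Rightarrow GG$ of functors $\mathbf{Sbs}\to\mathbf{Sbs}$, and let $\mathscr U_{[0,1]}$ be the uniform distribution on $[0,1]$. **Theorem.** For every standard Borel space $X$ the maps $\mathrm{base}_X: GX\times\nabla\to GGX$ and $\mathrm{mc}:GX\to\nabla$ are measurable. For every $\omega\in G\nabla$ the family $\{\omega\gg\!=\mathrm{base}_X\}_{X\in\mathbf{Sbs}}$ is a natural transformation $G\Rightarrow GG$, and the maps $$\alpha: G\nabla\to\mathrm{Nat}(G,GG),\qquad \omega\mapsto\{\omega\gg\!=\mathrm{base}_X\}_{X\in\mathbf{Sbs}},$$ $$\beta:\mathrm{Nat}(G,GG)\to G\nabla,\qquad H\mapsto G(\mathrm{mc})\big(H_{[0,1]}(\mathscr U_{[0,1]})\big),$$ are mutually inverse bijections. -/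

import Mathlib

open CategoryTheory MeasureTheory
open scoped ENNReal

noncomputable section

/-- An element-free probability distribution: a countably supported multiset of weights in
`(0, 1]`, given by its multiplicity function, whose total weight is at most `1`. -/
structure ElementFreeDist where
  /-- The multiplicity of each weight. -/
  mult : Set.Ioc (0 : ℝ) 1 → ℕ
  countable_support : (Function.support mult).Countable
  tsum_le_one : ∑' r : Set.Ioc (0 : ℝ) 1, (mult r : ℝ≥0∞) * ENNReal.ofReal (r : ℝ) ≤ 1

/-- The `σ`-algebra on element-free distributions generated by the sets of those `φ` that have
exactly `k` weights, counted with multiplicity, in the Borel set `U ⊆ (0, 1]`. -/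
instance ElementFreeDist.instMeasurableSpace : MeasurableSpace ElementFreeDist :=
  MeasurableSpace.generateFrom
    {D | ∃ U : Set (Set.Ioc (0 : ℝ) 1), MeasurableSet U ∧ ∃ k : ℕ,
      D = {φ : ElementFreeDist | ∑' r : U, (φ.mult r : ℝ≥0∞) = k}}

/-- The total weight of an element-free distribution. -/
def ElementFreeDist.totalWeight (φ : ElementFreeDist) : ℝ≥0∞ :=
  ∑' r : Set.Ioc (0 : ℝ) 1, (φ.mult r : ℝ≥0∞) * ENNReal.ofReal (r : ℝ)

/-- The entries of the multiset `φ`: the pairs `(r, i)` with `i < φ(r)`. The cardinality of this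
type is the size of `φ`, so families indexed by it are the sequences of that length, with the
entries belonging to the same weight `r` grouped together. -/
abbrev ElementFreeDist.Entries (φ : ElementFreeDist) : Type :=
  (r : Set.Ioc (0 : ℝ) 1) × Fin (φ.mult r)

section Multiplicity

variable {X : Type*} [MeasurableSpace X] [MeasurableSingletonClass X]

lemma tsum_atoms_le_one (μ : ProbabilityMeasure X) :
    ∑' x : X, (μ : Measure X) {x} ≤ 1 := by
  refine (ENNReal.tsum_eq_iSup_sum (f := fun x : X => (μ : Measure X) {x})).le.trans
    (iSup_le fun s => ?_)
  rw [sum_measure_singleton]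
  exact prob_le_one

/-- Only finitely many points have a given positive mass, so that the cardinality in the
multiplicity count is a genuine one. -/
lemma finite_setOf_measure_singleton_eq (μ : ProbabilityMeasure X) (r : Set.Ioc (0 : ℝ) 1) :
    {x : X | (μ : Measure X) {x} = ENNReal.ofReal (r : ℝ)}.Finite := by
  refine Set.Finite.subset (ENNReal.finite_const_le_of_tsum_ne_top
    (a := fun x : X => (μ : Measure X) {x}) (ne_top_of_le_ne_top ENNReal.one_ne_top
      (tsum_atoms_le_one μ)) (ε := ENNReal.ofReal (r : ℝ)) ?_) fun x hx => ?_
  · simpa using r.2.1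
  · exact (show (μ : Measure X) {x} = ENNReal.ofReal (r : ℝ) from hx).ge

lemma tsum_ncard_mul_le_one (μ : ProbabilityMeasure X) :
    ∑' r : Set.Ioc (0 : ℝ) 1,
      (({x : X | (μ : Measure X) {x} = ENNReal.ofReal (r : ℝ)}.ncard : ℕ) : ℝ≥0∞) *
        ENNReal.ofReal (r : ℝ) ≤ 1 := by
  have h (r : Set.Ioc (0 : ℝ) 1) :
      (({x : X | (μ : Measure X) {x} = ENNReal.ofReal (r : ℝ)}.ncard : ℕ) : ℝ≥0∞) *
        ENNReal.ofReal (r : ℝ) =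
      ∑' x : {x : X | (μ : Measure X) {x} = ENNReal.ofReal (r : ℝ)},
        (μ : Measure X) {(x : X)} := by
    have hfin := finite_setOf_measure_singleton_eq μ r
    have := hfin.fintype
    rw [tsum_congr (g := fun _ => ENNReal.ofReal (r : ℝ)) (fun x => x.2), tsum_fintype,
      Finset.sum_const, Finset.card_univ, nsmul_eq_mul, ← Nat.card_eq_fintype_card,
      Nat.card_coe_set_eq]
  simp_rw [h]
  rw [← ENNReal.tsum_sigma
    (fun (r : Set.Ioc (0 : ℝ) 1)
      (x : {x : X | (μ : Measure X) {x} = ENNReal.ofReal (r : ℝ)}) =>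
        (μ : Measure X) {(x : X)})]
  refine le_trans (ENNReal.tsum_comp_le_tsum_of_injective
    (f := fun p : (r : Set.Ioc (0 : ℝ) 1) ×
      {x : X | (μ : Measure X) {x} = ENNReal.ofReal (r : ℝ)} => (p.2 : X)) ?_
    (fun x : X => (μ : Measure X) {x})) (tsum_atoms_le_one μ)
  rintro ⟨r, x, hx⟩ ⟨r', x', hx'⟩ hxx
  obtain rfl : x = x' := hxx
  have hr : r = r' := by
    have h2 : ENNReal.ofReal (r : ℝ) = ENNReal.ofReal (r' : ℝ) :=
      (show (μ : Measure X) {x} = _ from hx).symm.trans hx'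
    exact Subtype.ext ((ENNReal.ofReal_eq_ofReal_iff r.2.1.le r'.2.1.le).1 h2)
  subst hr
  rfl

/-- The multiplicity count of a probability measure: `r ↦ #{x | μ {x} = r}`. -/
def multCount (μ : ProbabilityMeasure X) : ElementFreeDist where
  mult r := {x : X | (μ : Measure X) {x} = ENNReal.ofReal (r : ℝ)}.ncard
  countable_support := by
    refine (Summable.countable_support_ennreal
      (ne_top_of_le_ne_top ENNReal.one_ne_top (tsum_ncard_mul_le_one μ))).mono fun r hr => ?_
    simp only [Function.mem_support] at hr ⊢
    refine mul_ne_zero (by exact_mod_cast hr) ?_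
    simpa using r.2.1
  tsum_le_one := tsum_ncard_mul_le_one μ

end Multiplicity

section Base

variable {X : Type*} [MeasurableSpace X]

/-- The subprobability measure `∑_r r · ∑_{i < φ(r)} δ_{x (r, i)}`. -/
def ElementFreeDist.alloc (φ : ElementFreeDist) (x : φ.Entries → X) : Measure X :=
  Measure.sum fun s : φ.Entries => ENNReal.ofReal (s.1 : ℝ) • Measure.dirac (x s)

lemma ElementFreeDist.alloc_univ (φ : ElementFreeDist) (x : φ.Entries → X) :
    φ.alloc x Set.univ = φ.totalWeight := by
  simp only [ElementFreeDist.alloc, ElementFreeDist.totalWeight,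
    Measure.sum_apply _ MeasurableSet.univ, Measure.smul_apply, measure_univ, smul_eq_mul,
    mul_one]
  rw [ENNReal.tsum_sigma (fun (r : Set.Ioc (0 : ℝ) 1) (_ : Fin (φ.mult r)) =>
    ENNReal.ofReal (r : ℝ))]
  simp

instance ElementFreeDist.countable_entries (φ : ElementFreeDist) : Countable φ.Entries := by
  have : Countable (Function.support φ.mult) := φ.countable_support
  refine Function.Injective.countable
    (β := (r : Function.support φ.mult) × Fin (φ.mult r))
    (f := fun s => ⟨⟨s.1, fun h => (Fin.cast h s.2).elim0⟩, s.2⟩) ?_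
  rintro ⟨r, i⟩ ⟨r', i'⟩ h
  simp only [Sigma.mk.injEq] at h
  obtain ⟨h1, h2⟩ := h
  obtain rfl : r = r' := congrArg Subtype.val h1
  obtain rfl := eq_of_heq h2
  rfl

/-- The probability measure `(1 - tt(φ)) μ + alloc(φ, x)`. -/
def ElementFreeDist.fill (φ : ElementFreeDist) (μ : ProbabilityMeasure X)
    (x : φ.Entries → X) : ProbabilityMeasure X :=
  ⟨(1 - φ.totalWeight) • (μ : Measure X) + φ.alloc x, ⟨by
    rw [Measure.add_apply, Measure.smul_apply, measure_univ, smul_eq_mul, mul_one,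
      φ.alloc_univ, tsub_add_cancel_of_le (show φ.totalWeight ≤ 1 from φ.tsum_le_one)]⟩⟩

lemma ElementFreeDist.measurable_fill (φ : ElementFreeDist) (μ : ProbabilityMeasure X) :
    Measurable (φ.fill μ) := by
  refine Measurable.subtype_mk (Measure.measurable_of_measurable_coe _ fun s hs => ?_)
  simp only [Measure.add_apply, ElementFreeDist.alloc, Measure.sum_apply _ hs,
    Measure.smul_apply, Measure.dirac_apply' _ hs, smul_eq_mul]
  refine measurable_const.add (Measurable.tsum fun i => measurable_const.mul ?_)
  exact (measurable_one.indicator hs).comp (measurable_pi_apply i)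

/-- Drawing elements from the base measure `μ`: the law of `(1 - tt(φ)) μ + alloc(φ, x)` when the
family `x`, indexed by the entries of `φ`, is independent and identically distributed with law
`μ`. -/
def baseKernel (μ : ProbabilityMeasure X) (φ : ElementFreeDist) :
    ProbabilityMeasure (ProbabilityMeasure X) :=
  ⟨(Measure.infinitePi fun _ : φ.Entries => (μ : Measure X)).map (φ.fill μ),
    Measure.isProbabilityMeasure_map (φ.measurable_fill μ).aemeasurable⟩

end Base

/-- The functor of probability measures on measurable spaces: on maps it is the push-forward. -/
def giryProb : MeasCat.{0} ⥤ MeasCat.{0} where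
  obj X := MeasCat.of (ProbabilityMeasure X)
  map {X _} f := ⟨fun μ : ProbabilityMeasure X => μ.map (f := f.1) f.2.aemeasurable,
    Measurable.subtype_mk ((Measure.measurable_map f.1 f.2).comp measurable_subtype_coe)⟩
  map_id X := Subtype.ext <| funext fun μ : ProbabilityMeasure X =>
    Subtype.ext (Measure.map_id (μ := (μ : Measure X)))
  map_comp {X _ _} f g := Subtype.ext <| funext fun μ : ProbabilityMeasure X =>
    Subtype.ext (Measure.map_map (μ := (μ : Measure X)) g.2 f.2).symm

/-- The category of standard Borel spaces and measurable functions, as a full subcategory of the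
category of measurable spaces. -/
abbrev Sbs : Type 1 :=
  ObjectProperty.FullSubcategory fun X : MeasCat.{0} => StandardBorelSpace X

/-- The inclusion of standard Borel spaces in measurable spaces. -/
abbrev sbsInclusion : Sbs ⥤ MeasCat.{0} :=
  ObjectProperty.ι fun X : MeasCat.{0} => StandardBorelSpace X

/-- The natural transformations `G ⟶ G G` on standard Borel spaces. As the subcategory is full, it
does not matter that the functors are written here with values in measurable spaces. -/
abbrev GiryNat : Type 1 :=
  (sbsInclusion ⋙ giryProb) ⟶ (sbsInclusion ⋙ giryProb ⋙ giryProb)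

/-- The component of a natural transformation at a standard Borel space, as a function. -/
def GiryNat.component (H : GiryNat) (X : Type) [MeasurableSpace X] [hX : StandardBorelSpace X]
    (μ : ProbabilityMeasure X) : ProbabilityMeasure (ProbabilityMeasure X) :=
  (H.app ⟨MeasCat.of X, hX⟩).1 μ

/-- The uniform distribution on `[0, 1]`. -/
def uniformUnit : ProbabilityMeasure unitInterval :=
  ⟨volume, inferInstance⟩

end

open ProbabilityTheory Set Filter Topology

/-! One composite is direct: over an atomless base the independent points are almost surely
distinct, so the atoms of the filled measure carry exactly the weights of `φ`. Hence `multCount`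
recovers `φ` almost surely, and recovers `ω` from the mixture (`map_multCount_bindBase`).

The other composite reduces to injectivity of `β` (`GiryNat.eq_of_map_multCount_eq`). Every law on a
standard Borel space is an image of the uniform law on the circle, so by naturality `H` is
determined by the law `Q` it assigns to the uniform circle. `Q` is determined by its moments, the
integrals of `∏ i, ν (A i)`.

Let `P` be the law assigned to the uniform law on `[0, 1]`. Stretching `[0, 1]` around the circle
`N` times, with an arbitrary rotation on each lap, preserves uniformity, so by naturality `Q` is the
image of `P` under each such map. Average over independent uniform rotations and let `N → ∞`.
Distinct points end up on different laps, so a sample from `ν` receives independent uniform labels,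
one for each distinct point. The moments of `Q` therefore depend only on the equality pattern of
samples from `ν ∼ P` (`lintegral_prod_eq_lintegral_labelProb`). By a coupling
(`hasAtomCoupling_fill`), the law of that pattern depends on `ν` only through `multCount ν`. -/

namespace ElementFreeDist

/-! ### Counting weights, and the σ-algebra on element-free distributions. -/

lemma tsum_mult_mul (φ : ElementFreeDist) (f : Ioc (0 : ℝ) 1 → ℝ≥0∞) :
    ∑' r, (φ.mult r : ℝ≥0∞) * f r = ∑' s : φ.Entries, f s.1 := by
  rw [ENNReal.tsum_sigma (fun (r : Ioc (0 : ℝ) 1) (_ : Fin (φ.mult r)) => f r)]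
  simp

/-- The number of weights in a set, counted with multiplicity. -/
noncomputable def count (φ : ElementFreeDist) (U : Set (Ioc (0 : ℝ) 1)) : ℝ≥0∞ :=
  ∑' r : U, (φ.mult r : ℝ≥0∞)

lemma count_eq_encard (φ : ElementFreeDist) (U : Set (Ioc (0 : ℝ) 1)) :
    φ.count U = ({s : φ.Entries | s.1 ∈ U}.encard : ℕ∞) := by
  rw [count, ← ENNReal.tsum_set_one, tsum_subtype U (fun r => (φ.mult r : ℝ≥0∞)),
    tsum_subtype _ (fun _ => (1 : ℝ≥0∞))]
  have := φ.tsum_mult_mul (U.indicator 1)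
  refine Eq.trans (tsum_congr fun r => ?_) (this.trans (tsum_congr fun s => ?_))
  · by_cases h : r ∈ U <;> simp [h]
  · by_cases h : s.1 ∈ U <;> simp [h]

/-- The generating sets control the finite values. The only other value is `∞`, whose fibre is a
countable intersection of their complements. -/
lemma measurable_count {U : Set (Ioc (0 : ℝ) 1)} (hU : MeasurableSet U) :
    Measurable fun φ : ElementFreeDist => φ.count U := by
  have h (k : ℕ) : MeasurableSet {φ : ElementFreeDist | φ.count U = k} :=
    MeasurableSpace.measurableSet_generateFrom ⟨U, hU, k, rfl⟩
  have hk (k : ℕ) : (fun φ : ElementFreeDist => {s : φ.Entries | s.1 ∈ U}.encard) ⁻¹' {(k : ℕ∞)} =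
      {φ : ElementFreeDist | φ.count U = (k : ℝ≥0∞)} := by
    ext φ
    simp only [mem_preimage, mem_singleton_iff, mem_ofPred_eq, count_eq_encard]
    norm_cast
  simp_rw [count_eq_encard]
  have hm : Measurable fun n : ℕ∞ => (n : ℝ≥0∞) := measurable_from_top
  refine hm.comp (measurable_to_countable' fun n => ?_)
  induction n using ENat.recTopCoe with
  | coe k => rw [hk]; exact h k
  | top =>
    have : (fun φ : ElementFreeDist => {s : φ.Entries | s.1 ∈ U}.encard) ⁻¹' {(⊤ : ℕ∞)} =
        ⋂ k : ℕ, {φ : ElementFreeDist | φ.count U = (k : ℝ≥0∞)}ᶜ := by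
      ext φ
      simp only [← hk, mem_iInter, mem_compl_iff, mem_preimage, mem_singleton_iff]
      exact ENat.eq_top_iff_forall_ne.trans (forall_congr' fun _ => ne_comm)
    rw [this]
    exact MeasurableSet.iInter fun k => (h k).compl

lemma measurable_of_count {α : Type*} [MeasurableSpace α] {f : α → ElementFreeDist}
    (hf : ∀ U, MeasurableSet U → Measurable fun a => (f a).count U) : Measurable f := by
  refine measurable_generateFrom ?_
  rintro _ ⟨U, hU, k, rfl⟩
  exact hf U hU (measurableSet_singleton (k : ℝ≥0∞))

end ElementFreeDist

/-! ### Measurability of the multiplicity count. -/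

section Atoms

variable {X : Type*} [MeasurableSpace X]

lemma countable_setOf_measure_singleton_ne_zero [MeasurableSingletonClass X]
    (μ : ProbabilityMeasure X) : {x : X | (μ : Measure X) {x} ≠ 0}.Countable :=
  Summable.countable_support_ennreal (f := fun x : X => (μ : Measure X) {x})
    (ne_top_of_le_ne_top ENNReal.one_ne_top (tsum_atoms_le_one μ))

/-- The identity, as a Markov kernel from probability measures to points. -/
noncomputable def evalKernel (X : Type*) [MeasurableSpace X] : Kernel (ProbabilityMeasure X) X :=
  ⟨fun μ => μ, measurable_subtype_coe⟩

instance : IsMarkovKernel (evalKernel X) := ⟨fun μ => μ.2⟩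

/-- The singleton is a section of the diagonal, which is measurable, so kernel measurability
applies. -/
lemma measurable_measure_singleton [MeasurableEq X] :
    Measurable fun p : ProbabilityMeasure X × X => (p.1 : Measure X) {p.2} := by
  have := Kernel.measurable_kernel_prodMk_left (κ := (evalKernel X).comap
    (Prod.fst : ProbabilityMeasure X × X → _) measurable_fst)
    (t := {q | q.2 = q.1.2}) (measurableSet_eq_fun measurable_snd measurable_fst.snd)
  exact this

/-- Each atom with mass in `U` contributes `(μ {x})⁻¹ * μ {x} = 1` to the integral. Writing the
count as an integral makes its dependence on `μ` visibly measurable. -/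
lemma count_multCount [MeasurableEq X] (μ : ProbabilityMeasure X)
    {U : Set (Ioc (0 : ℝ) 1)} (hU : MeasurableSet U) :
    (multCount μ).count U = ∫⁻ x, {a : ℝ≥0∞ | a ≠ ∞ ∧ a.toReal ∈ Subtype.val '' U}.indicator
      (fun a => a⁻¹) ((μ : Measure X) {x}) ∂(μ : Measure X) := by
  set V : Set ℝ≥0∞ := {a : ℝ≥0∞ | a ≠ ∞ ∧ a.toReal ∈ Subtype.val '' U}
  have hV : MeasurableSet V := (measurableSet_singleton _).compl.inter
    (ENNReal.measurable_toReal (MeasurableSet.subtype_image measurableSet_Ioc hU))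
  have hV0 {a : ℝ≥0∞} (ha : a ∈ V) : a ≠ 0 := by
    rintro rfl
    obtain ⟨r, -, hr⟩ := ha.2
    have := r.2.1
    simp_all
  set S : Set X := {x | (μ : Measure X) {x} ∈ V}
  have hSm : MeasurableSet S :=
    (measurable_measure_singleton.comp (measurable_const.prodMk measurable_id) :
      Measurable fun x => (μ : Measure X) {x}) hV
  have hSc : S.Countable := (countable_setOf_measure_singleton_ne_zero μ).mono fun x hx => hV0 hx
  have h1 : (fun x => V.indicator (fun a => a⁻¹) ((μ : Measure X) {x})) =
      S.indicator fun x => ((μ : Measure X) {x})⁻¹ := by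
    ext x
    by_cases hx : (μ : Measure X) {x} ∈ V
    · rw [indicator_of_mem hx, indicator_of_mem (show x ∈ S from hx)]
    · rw [indicator_of_notMem hx, indicator_of_notMem (show x ∉ S from hx)]
  rw [h1, lintegral_indicator hSm, lintegral_countable _ hSc,
    tsum_congr (g := fun _ => (1 : ℝ≥0∞))
      fun x => ENNReal.inv_mul_cancel (hV0 x.2) (measure_ne_top _ _)]
  have h2 (r : U) : ((multCount μ).mult r : ℝ≥0∞) =
      ∑' _ : {x : X | (μ : Measure X) {x} = ENNReal.ofReal (r : Ioc (0 : ℝ) 1)}, 1 := by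
    rw [ENNReal.tsum_set_one, ← (finite_setOf_measure_singleton_eq μ r).cast_ncard_eq]
    simp [multCount]
  rw [ElementFreeDist.count, tsum_congr h2, ← ENNReal.tsum_sigma (fun (r : U)
    (_ : {x : X | (μ : Measure X) {x} = ENNReal.ofReal (r : Ioc (0 : ℝ) 1)}) => 1)]
  -- Atoms grouped by mass correspond bijectively to all atoms with mass in `U`.
  let f : (Σ r : U, {x : X | (μ : Measure X) {x} = ENNReal.ofReal (r : Ioc (0 : ℝ) 1)}) → S :=
    fun p => ⟨p.2, by
      have h : (μ : Measure X) {(p.2 : X)} = ENNReal.ofReal (p.1 : Ioc (0 : ℝ) 1) := p.2.2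
      refine ⟨measure_ne_top _ _, p.1, p.1.2, ?_⟩
      rw [h, ENNReal.toReal_ofReal (p.1 : Ioc (0 : ℝ) 1).2.1.le]⟩
  have hf : Function.Bijective f := by
    constructor
    · rintro ⟨⟨r, hrU⟩, x, hx⟩ ⟨⟨r', hrU'⟩, x', hx'⟩ hxx
      obtain rfl : x = x' := congrArg Subtype.val hxx
      have hr : r = r' := by
        have h2 : ENNReal.ofReal (r : ℝ) = ENNReal.ofReal (r' : ℝ) :=
          (show (μ : Measure X) {x} = _ from hx).symm.trans hx'
        exact Subtype.ext ((ENNReal.ofReal_eq_ofReal_iff r.2.1.le r'.2.1.le).1 h2)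
      subst hr
      rfl
    · rintro ⟨x, hx, r, hr, hrx⟩
      refine ⟨⟨⟨r, hr⟩, x, ?_⟩, rfl⟩
      change _ = ENNReal.ofReal (r : ℝ)
      rw [hrx, ENNReal.ofReal_toReal hx]
  exact (Equiv.ofBijective f hf).tsum_eq fun _ => (1 : ℝ≥0∞)

lemma measurable_multCount [MeasurableEq X] :
    Measurable fun μ : ProbabilityMeasure X => multCount μ := by
  refine ElementFreeDist.measurable_of_count fun U hU => ?_
  simp_rw [count_multCount _ hU]
  refine Measurable.lintegral_kernel_prod_right (κ := evalKernel X) (f := fun μ x =>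
    {a : ℝ≥0∞ | a ≠ ∞ ∧ a.toReal ∈ Subtype.val '' U}.indicator (fun a => a⁻¹)
      ((μ : Measure X) {x})) ?_
  refine Measurable.comp (Measurable.indicator measurable_inv ?_) measurable_measure_singleton
  exact (measurableSet_singleton _).compl.inter
    (ENNReal.measurable_toReal (MeasurableSet.subtype_image measurableSet_Ioc hU))

end Atoms

/-! ### Enumeration of the entries by decreasing weight. -/

namespace ElementFreeDist

/-- The order on entries by decreasing weight. -/
def Precedes (φ : ElementFreeDist) (s s' : φ.Entries) : Prop :=
  s'.1 < s.1 ∨ s.1 = s'.1 ∧ (s.2 : ℕ) < s'.2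

/-- The position of an entry in the enumeration by decreasing weight. -/
noncomputable def rank (φ : ElementFreeDist) (s : φ.Entries) : ℕ :=
  {s' | φ.Precedes s' s}.ncard

variable (φ : ElementFreeDist)

lemma totalWeight_eq_tsum : φ.totalWeight = ∑' s : φ.Entries, ENNReal.ofReal (s.1 : ℝ) :=
  φ.tsum_mult_mul fun r => ENNReal.ofReal (r : ℝ)

lemma finite_setOf_le_weight (t : Ioc (0 : ℝ) 1) : {s : φ.Entries | t ≤ s.1}.Finite := by
  refine Set.Finite.subset (ENNReal.finite_const_le_of_tsum_ne_top
    (a := fun s : φ.Entries => ENNReal.ofReal (s.1 : ℝ)) ?_ (ε := ENNReal.ofReal (t : ℝ)) ?_)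
    fun s hs => ENNReal.ofReal_le_ofReal hs
  · rw [← totalWeight_eq_tsum]
    exact ne_top_of_le_ne_top ENNReal.one_ne_top φ.tsum_le_one
  · simpa using t.2.1

variable {φ}

lemma Precedes.le {s s' : φ.Entries} (h : φ.Precedes s s') : s'.1 ≤ s.1 :=
  h.elim le_of_lt fun h => h.1.ge

lemma Precedes.irrefl (s : φ.Entries) : ¬ φ.Precedes s s := by
  simp [Precedes]

lemma Precedes.trans {s s' s'' : φ.Entries} (h : φ.Precedes s s') (h' : φ.Precedes s' s'') :
    φ.Precedes s s'' := by
  rcases h with h | ⟨h1, h2⟩ <;> rcases h' with h' | ⟨h1', h2'⟩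
  · exact .inl (h'.trans h)
  · exact .inl (h1' ▸ h)
  · exact .inl (h1 ▸ h')
  · exact .inr ⟨h1.trans h1', h2.trans h2'⟩

lemma precedes_or_precedes {s s' : φ.Entries} (h : s ≠ s') :
    φ.Precedes s s' ∨ φ.Precedes s' s := by
  obtain ⟨r, i⟩ := s
  obtain ⟨r', i'⟩ := s'
  rcases lt_trichotomy r r' with hr | rfl | hr
  · exact .inr (.inl hr)
  · have hi : i ≠ i' := fun hi => h (by rw [hi])
    rcases lt_or_gt_of_ne hi with hi | hi
    · exact .inl (.inr ⟨rfl, hi⟩)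
    · exact .inr (.inr ⟨rfl, hi⟩)
  · exact .inl (.inl hr)

lemma finite_setOf_precedes (s : φ.Entries) : {s' | φ.Precedes s' s}.Finite :=
  (φ.finite_setOf_le_weight s.1).subset fun _ h => h.le

lemma Precedes.rank_lt {s s' : φ.Entries} (h : φ.Precedes s s') : φ.rank s < φ.rank s' :=
  ncard_lt_ncard ⟨fun _ hs => Precedes.trans hs h, fun hs => Precedes.irrefl s (hs h)⟩
    (finite_setOf_precedes s')

variable (φ)

lemma rank_injective : Function.Injective φ.rank := by
  intro s s' h
  by_contra hne
  rcases precedes_or_precedes hne with hs | hs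
  · exact hs.rank_lt.ne h
  · exact hs.rank_lt.ne' h

lemma rank_lt_ncard {t : Ioc (0 : ℝ) 1} {s : φ.Entries} (h : t ≤ s.1) :
    φ.rank s < {s : φ.Entries | t ≤ s.1}.ncard :=
  ncard_lt_ncard ⟨fun _ hs => h.trans hs.le, fun hs => Precedes.irrefl s (hs h)⟩
    (φ.finite_setOf_le_weight t)

/-- The ranks of the entries of weight at least `t` form an initial segment of `ℕ`: they are
distinct, they lie below the number of such entries, and there are exactly that many of them. -/
lemma lt_ncard_iff (t : Ioc (0 : ℝ) 1) (n : ℕ) :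
    n < {s : φ.Entries | t ≤ s.1}.ncard ↔ ∃ s : φ.Entries, φ.rank s = n ∧ t ≤ s.1 := by
  refine ⟨fun hn => ?_, ?_⟩
  · have hsub : φ.rank '' {s : φ.Entries | t ≤ s.1} ⊆
        Set.Iio {s : φ.Entries | t ≤ s.1}.ncard := by
      rintro _ ⟨s, hs, rfl⟩
      exact φ.rank_lt_ncard hs
    have heq := eq_of_subset_of_ncard_le hsub
      (by rw [ncard_image_of_injective _ φ.rank_injective, ncard_Iio_nat])
      (finite_Iio _)
    obtain ⟨s, hs, h⟩ := heq.ge (show n ∈ Set.Iio _ from hn)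
    exact ⟨s, h, hs⟩
  · rintro ⟨s, rfl, h⟩
    exact φ.rank_lt_ncard h

/-- The `n`-th largest weight, counted with multiplicity; zero if there is none. -/
noncomputable def weight (φ : ElementFreeDist) (n : ℕ) : ℝ≥0∞ :=
  ∑' s : φ.Entries, ({n} : Set ℕ).indicator (fun _ => ENNReal.ofReal (s.1 : ℝ)) (φ.rank s)

lemma weight_rank (s : φ.Entries) : φ.weight (φ.rank s) = ENNReal.ofReal (s.1 : ℝ) := by
  rw [weight, tsum_eq_single s]
  · simp
  · intro s' hs'
    exact indicator_of_notMem (s := {φ.rank s}) (fun h => hs' (φ.rank_injective h)) _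

lemma weight_eq_zero {n : ℕ} (hn : ∀ s, φ.rank s ≠ n) : φ.weight n = 0 := by
  rw [weight, ENNReal.tsum_eq_zero]
  exact fun s => indicator_of_notMem (s := {n}) (hn s) _

lemma tsum_weight_mul (f : ℕ → ℝ≥0∞) :
    ∑' n, φ.weight n * f n = ∑' s : φ.Entries, ENNReal.ofReal (s.1 : ℝ) * f (φ.rank s) := by
  simp_rw [weight, ← ENNReal.tsum_mul_right]
  rw [ENNReal.tsum_comm]
  refine tsum_congr fun s => ?_
  rw [tsum_eq_single (φ.rank s)]
  · simp
  · intro n hn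
    rw [indicator_of_notMem (fun h => hn h.symm), zero_mul]

lemma totalWeight_eq_tsum_weight : φ.totalWeight = ∑' n, φ.weight n := by
  simpa [totalWeight_eq_tsum] using (φ.tsum_weight_mul 1).symm

/-- Ranks start at `0`, hence the strict inequality. As `t > 0`, the default weight `0` never
satisfies the left side. This reduces measurability of the weights to that of counts. -/
lemma le_weight_iff (t : Ioc (0 : ℝ) 1) (n : ℕ) :
    ENNReal.ofReal (t : ℝ) ≤ φ.weight n ↔ (n : ℝ≥0∞) < φ.count (Ici t) := by
  have h : φ.count (Ici t) = ({s : φ.Entries | t ≤ s.1}.ncard : ℝ≥0∞) := by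
    rw [count_eq_encard, show {s : φ.Entries | s.1 ∈ Ici t} = {s | t ≤ s.1} from rfl,
      ← (φ.finite_setOf_le_weight t).cast_ncard_eq]
    simp
  rw [h, Nat.cast_lt, lt_ncard_iff]
  constructor
  · intro hle
    by_cases hn : ∃ s, φ.rank s = n
    · obtain ⟨s, rfl⟩ := hn
      rw [weight_rank, ENNReal.ofReal_le_ofReal_iff s.1.2.1.le] at hle
      exact ⟨s, rfl, hle⟩
    · rw [φ.weight_eq_zero (not_exists.1 hn)] at hle
      have := t.2.1
      simp at hle
      linarith
  · rintro ⟨s, rfl, hs⟩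
    rw [weight_rank]
    exact ENNReal.ofReal_le_ofReal hs

lemma weight_le_one (n : ℕ) : φ.weight n ≤ 1 :=
  (ENNReal.le_tsum n).trans (φ.totalWeight_eq_tsum_weight.symm.trans_le φ.tsum_le_one)

lemma measurable_weight (n : ℕ) : Measurable fun φ : ElementFreeDist => φ.weight n := by
  refine measurable_of_Ici fun a => ?_
  rcases eq_or_ne a 0 with rfl | ha
  · simp
  rcases lt_or_ge 1 a with h1 | h1
  · convert MeasurableSet.empty
    ext φ
    simpa using (φ.weight_le_one n).trans_lt h1
  have hat : a ≠ ∞ := ne_top_of_le_ne_top ENNReal.one_ne_top h1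
  let t : Ioc (0 : ℝ) 1 := ⟨a.toReal, ENNReal.toReal_pos ha hat,
    ENNReal.toReal_le_of_le_ofReal zero_le_one (by simpa using h1)⟩
  have ht : ENNReal.ofReal (t : ℝ) = a := ENNReal.ofReal_toReal hat
  have : (fun φ : ElementFreeDist => φ.weight n) ⁻¹' Ici a =
      (fun φ : ElementFreeDist => φ.count (Ici t)) ⁻¹' Ioi (n : ℝ≥0∞) := by
    ext φ
    rw [mem_preimage, mem_Ici, ← ht, le_weight_iff, mem_preimage, mem_Ioi]
  rw [this]
  exact measurable_count measurableSet_Ici measurableSet_Ioi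

lemma measurable_totalWeight : Measurable totalWeight := by
  simp_rw [funext totalWeight_eq_tsum_weight]
  exact Measurable.tsum fun n => measurable_weight n

end ElementFreeDist

/-! ### Joint measurability of `baseKernel`. -/

section BaseMeasurable

variable {X : Type*} [MeasurableSpace X]

/-- It suffices to test on the π-system of boxes with finitely many constraints, where the measure
is a finite product of masses. -/
lemma MeasureTheory.ProbabilityMeasure.measurable_infinitePi (ι : Type*) :
    Measurable fun μ : ProbabilityMeasure X => Measure.infinitePi fun _ : ι => (μ : Measure X) := by
  refine Measurable.measure_of_isPiSystem_of_isProbabilityMeasure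
    generateFrom_squareCylinders.symm
    (isPiSystem_squareCylinders (fun _ => MeasurableSpace.isPiSystem_measurableSet) (by simp)) ?_
  rintro _ ⟨s, t, ht, rfl⟩
  have ht' (i : ι) : MeasurableSet (t i) := ht i (mem_univ i)
  simp_rw [Measure.infinitePi_pi _ fun i _ => ht' i]
  exact Finset.measurable_fun_prod _ fun i _ =>
    (Measure.measurable_coe (ht' i)).comp measurable_subtype_coe

/-- The law of an independent and identically distributed family, as a Markov kernel. -/
noncomputable def iidKernel (ι X : Type*) [MeasurableSpace X] :
    Kernel (ProbabilityMeasure X) (ι → X) :=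
  ⟨fun μ => Measure.infinitePi fun _ => μ, ProbabilityMeasure.measurable_infinitePi ι⟩

instance (ι : Type*) : IsMarkovKernel (iidKernel ι X) := ⟨fun μ =>
  inferInstanceAs (IsProbabilityMeasure (Measure.infinitePi fun _ => (μ : Measure X)))⟩

lemma ElementFreeDist.fill_comp_rank_apply (φ : ElementFreeDist) (μ : ProbabilityMeasure X)
    (x : ℕ → X) {A : Set X} (hA : MeasurableSet A) :
    (φ.fill μ (x ∘ φ.rank) : Measure X) A =
      (1 - φ.totalWeight) * (μ : Measure X) A + ∑' n, φ.weight n * A.indicator 1 (x n) := by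
  rw [φ.tsum_weight_mul fun n => A.indicator 1 (x n)]
  simp [fill, alloc, Measure.sum_apply _ hA, Measure.dirac_apply' _ hA]

lemma measurable_fill_comp_rank :
    Measurable fun q : (ProbabilityMeasure X × ElementFreeDist) × (ℕ → X) =>
      q.1.2.fill q.1.1 (q.2 ∘ q.1.2.rank) := by
  refine Measurable.subtype_mk (Measure.measurable_of_measurable_coe _ fun A hA => ?_)
  have h (q : (ProbabilityMeasure X × ElementFreeDist) × (ℕ → X)) :=
    q.1.2.fill_comp_rank_apply q.1.1 q.2 hA
  simp only [ElementFreeDist.fill, ProbabilityMeasure.coe_mk] at h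
  simp_rw [h]
  refine Measurable.add (Measurable.mul ?_ ?_) (Measurable.tsum fun n => Measurable.mul ?_ ?_)
  · exact measurable_const.sub (ElementFreeDist.measurable_totalWeight.comp measurable_fst.snd)
  · exact (Measure.measurable_coe hA).comp (measurable_subtype_coe.comp measurable_fst.fst)
  · exact (ElementFreeDist.measurable_weight n).comp measurable_fst.snd
  · exact (measurable_one.indicator hA).comp ((measurable_pi_apply n).comp measurable_snd)

/-- The family indexed by entries is a marginal of an i.i.d. sequence, because `rank` is injective.
The sample space then no longer depends on `φ`. -/
lemma baseKernel_apply (μ : ProbabilityMeasure X) (φ : ElementFreeDist)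
    {B : Set (ProbabilityMeasure X)} (hB : MeasurableSet B) :
    (baseKernel μ φ : Measure (ProbabilityMeasure X)) B =
      iidKernel ℕ X μ {x | φ.fill μ (x ∘ φ.rank) ∈ B} := by
  have h : (Measure.infinitePi fun _ : ℕ => (μ : Measure X)).map (fun x s => x (φ.rank s)) =
      Measure.infinitePi fun _ : φ.Entries => (μ : Measure X) :=
    Measure.map_infinitePi_infinitePi_of_inj φ.rank_injective
  rw [baseKernel, ProbabilityMeasure.coe_mk, ← h, Measure.map_map (φ.measurable_fill μ)
    (by fun_prop), Measure.map_apply ((φ.measurable_fill μ).comp (by fun_prop)) hB]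
  rfl

lemma measurable_baseKernel :
    Measurable fun p : ProbabilityMeasure X × ElementFreeDist => baseKernel p.1 p.2 := by
  refine Measurable.subtype_mk (Measure.measurable_of_measurable_coe _ fun B hB => ?_)
  have h (p : ProbabilityMeasure X × ElementFreeDist) := baseKernel_apply p.1 p.2 hB
  simp only [baseKernel, ProbabilityMeasure.coe_mk] at h
  simp_rw [h]
  exact Kernel.measurable_kernel_prodMk_left (κ := (iidKernel ℕ X).comap
    (Prod.fst : ProbabilityMeasure X × ElementFreeDist → _) measurable_fst)
    (measurable_fill_comp_rank hB)

end BaseMeasurable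

/-! ### Naturality of `baseKernel`. -/

section Naturality

variable {X Y : Type*} [MeasurableSpace X] [MeasurableSpace Y]

lemma MeasureTheory.ProbabilityMeasure.measurable_map {f : X → Y} (hf : Measurable f) :
    Measurable fun μ : ProbabilityMeasure X => μ.map hf.aemeasurable :=
  Measurable.subtype_mk ((Measure.measurable_map f hf).comp measurable_subtype_coe)

lemma ElementFreeDist.fill_map (φ : ElementFreeDist) (μ : ProbabilityMeasure X) {f : X → Y}
    (hf : Measurable f) (x : φ.Entries → X) :
    (φ.fill μ x).map hf.aemeasurable = φ.fill (μ.map hf.aemeasurable) (f ∘ x) := by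
  refine Subtype.ext (Measure.ext fun A hA => ?_)
  change (φ.fill μ x : Measure X).map f A = _
  rw [Measure.map_apply hf hA]
  simp only [fill, alloc, ProbabilityMeasure.coe_mk, Measure.add_apply, Measure.smul_apply,
    Measure.sum_apply _ hA, Measure.sum_apply _ (hf hA), Measure.dirac_apply' _ hA,
    Measure.dirac_apply' _ (hf hA), ProbabilityMeasure.toMeasure_map, Measure.map_apply hf hA]
  rfl

lemma baseKernel_map (μ : ProbabilityMeasure X) (φ : ElementFreeDist) {f : X → Y}
    (hf : Measurable f) :
    (baseKernel μ φ : Measure (ProbabilityMeasure X)).map (fun ν => ν.map hf.aemeasurable) =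
      baseKernel (μ.map hf.aemeasurable) φ := by
  have h : (Measure.infinitePi fun _ : φ.Entries => (μ : Measure X)).map (fun x s => f (x s)) =
      Measure.infinitePi fun _ : φ.Entries => (μ : Measure X).map f :=
    Measure.infinitePi_map_pi _ fun _ => hf
  have hm : (μ.map hf.aemeasurable : Measure Y) = (μ : Measure X).map f := rfl
  simp only [baseKernel, ProbabilityMeasure.coe_mk]
  rw [Measure.map_map (ProbabilityMeasure.measurable_map hf) (φ.measurable_fill μ)]
  simp_rw [hm]
  rw [← h, Measure.map_map (φ.measurable_fill _) (by fun_prop)]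
  congr 1
  ext1 x
  exact φ.fill_map μ hf x

end Naturality

/-! ### Atoms of filled measures, and enumeration of atoms. -/

section Atomless

variable {X : Type*} [MeasurableSpace X]

@[ext]
lemma ElementFreeDist.ext {φ ψ : ElementFreeDist} (h : φ.mult = ψ.mult) : φ = ψ := by
  cases φ
  cases ψ
  cases h
  rfl

variable [MeasurableSingletonClass X]

lemma ElementFreeDist.fill_singleton (φ : ElementFreeDist) (μ : ProbabilityMeasure X)
    [NullSingletonClass (μ : Measure X)] {x : φ.Entries → X} (hx : Function.Injective x) (s : φ.Entries) :
    (φ.fill μ x : Measure X) {x s} = ENNReal.ofReal (s.1 : ℝ) := by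
  simp only [fill, alloc, ProbabilityMeasure.coe_mk, Measure.add_apply, Measure.smul_apply,
    measure_singleton, smul_zero, zero_add, Measure.sum_apply _ (measurableSet_singleton _)]
  rw [tsum_eq_single s]
  · simp
  · intro s' hs'
    simp [hx.ne hs']

lemma ElementFreeDist.fill_singleton_eq_zero (φ : ElementFreeDist) (μ : ProbabilityMeasure X)
    [NullSingletonClass (μ : Measure X)] {x : φ.Entries → X} {y : X} (hy : ∀ s, x s ≠ y) :
    (φ.fill μ x : Measure X) {y} = 0 := by
  simp only [fill, alloc, ProbabilityMeasure.coe_mk, Measure.add_apply, Measure.smul_apply,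
    measure_singleton, smul_zero, zero_add, Measure.sum_apply _ (measurableSet_singleton _)]
  rw [ENNReal.tsum_eq_zero]
  intro s
  simp [hy s]

/-- The base has no atoms and the points are distinct, so the atoms are exactly the points `x s`,
with no weights merging. -/
lemma ElementFreeDist.multCount_fill (φ : ElementFreeDist) (μ : ProbabilityMeasure X)
    [NullSingletonClass (μ : Measure X)] {x : φ.Entries → X} (hx : Function.Injective x) :
    multCount (φ.fill μ x) = φ := by
  ext r
  have h : {y : X | (φ.fill μ x : Measure X) {y} = ENNReal.ofReal (r : ℝ)} =
      range fun i : Fin (φ.mult r) => x ⟨r, i⟩ := by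
    ext y
    simp only [mem_ofPred_eq, mem_range]
    constructor
    · intro hy
      by_cases hs : ∃ s, x s = y
      · obtain ⟨⟨r', i⟩, rfl⟩ := hs
        rw [φ.fill_singleton μ hx, ENNReal.ofReal_eq_ofReal_iff r'.2.1.le r.2.1.le] at hy
        obtain rfl : r' = r := Subtype.ext hy
        exact ⟨i, rfl⟩
      · rw [φ.fill_singleton_eq_zero μ (not_exists.1 hs), eq_comm, ENNReal.ofReal_eq_zero] at hy
        exact absurd r.2.1 hy.not_gt
    · rintro ⟨i, rfl⟩
      exact φ.fill_singleton μ hx ⟨r, i⟩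
  have hinj : Function.Injective fun i : Fin (φ.mult r) => x ⟨r, i⟩ := fun i j hij => by
    simpa using hx hij
  simp only [multCount]
  rw [h, ← image_univ, ncard_image_of_injective _ hinj, ncard_univ, Nat.card_fin]

lemma exists_enumeration_atoms (ν : ProbabilityMeasure X) :
    ∃ a : (multCount ν).Entries → X, Function.Injective a ∧
      (∀ s, (ν : Measure X) {a s} = ENNReal.ofReal (s.1 : ℝ)) ∧
      ∀ y, (ν : Measure X) {y} ≠ 0 → ∃ s, a s = y := by
  have hcard (r : Ioc (0 : ℝ) 1) : Nat.card (Fin ((multCount ν).mult r)) =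
      Nat.card {x : X | (ν : Measure X) {x} = ENNReal.ofReal (r : ℝ)} := by
    rw [Nat.card_fin, Nat.card_coe_set_eq]
    rfl
  have hfin (r : Ioc (0 : ℝ) 1) :
      Finite {x : X | (ν : Measure X) {x} = ENNReal.ofReal (r : ℝ)} :=
    finite_setOf_measure_singleton_eq ν r
  let b (r : Ioc (0 : ℝ) 1) : Fin ((multCount ν).mult r) ≃
      {x : X | (ν : Measure X) {x} = ENNReal.ofReal (r : ℝ)} := Classical.choice (Finite.card_eq.1 (hcard r))
  have hb (s : (multCount ν).Entries) :
      (ν : Measure X) {(b s.1 s.2 : X)} = ENNReal.ofReal (s.1 : ℝ) := (b s.1 s.2).2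
  refine ⟨fun s => b s.1 s.2, ?_, hb, ?_⟩
  · rintro ⟨r, i⟩ ⟨r', i'⟩ h
    have h1 := hb ⟨r, i⟩
    have h2 := hb ⟨r', i'⟩
    simp only at h h1 h2
    rw [h, h2, ENNReal.ofReal_eq_ofReal_iff r'.2.1.le r.2.1.le] at h1
    obtain rfl : r' = r := Subtype.ext h1
    rw [(b r').injective (Subtype.ext h)]
  · intro y hy
    let r : Ioc (0 : ℝ) 1 := ⟨((ν : Measure X) {y}).toReal,
      ENNReal.toReal_pos hy (measure_ne_top _ _),
      ENNReal.toReal_le_of_le_ofReal zero_le_one (by simpa using prob_le_one)⟩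
    have hr : (ν : Measure X) {y} = ENNReal.ofReal (r : ℝ) :=
      (ENNReal.ofReal_toReal (measure_ne_top _ _)).symm
    exact ⟨⟨r, (b r).symm ⟨y, hr⟩⟩, by simp⟩

end Atomless

/-! ### Samples from atomless laws. -/

section AtomlessBase

variable {X : Type*} [MeasurableSpace X] [MeasurableEq X]

/-- By Fubini the diagonal is null for `μ.prod μ`, and there are only countably many pairs of
indices. -/
lemma ae_injective_infinitePi {ι : Type*} [Countable ι] (μ : Measure X)
    [IsProbabilityMeasure μ] [NullSingletonClass μ] :
    ∀ᵐ x ∂(Measure.infinitePi fun _ : ι => μ), Function.Injective x := by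
  have h (i j : ι) (hij : i ≠ j) : ∀ᵐ x ∂(Measure.infinitePi fun _ : ι => μ), x i ≠ x j := by
    have h1 : ∀ᵐ p ∂(μ.prod μ), p.1 ≠ p.2 := by
      rw [Measure.ae_prod_iff_ae_ae
        (p := fun p => p.1 ≠ p.2) (measurableSet_eq_fun measurable_fst measurable_snd).compl]
      refine .of_forall fun y => ?_
      exact (measure_eq_zero_iff_ae_notMem.1 (measure_singleton (μ := μ) y)).mono
        fun z hz h => hz h.symm
    rw [← Measure.infinitePi_map_eval_prod (P := fun _ : ι => μ) hij] at h1
    exact ae_of_ae_map (f := fun x : ι → X => (x i, x j)) (by fun_prop) h1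
  have h' : ∀ᵐ x ∂(Measure.infinitePi fun _ : ι => μ), ∀ i j, i ≠ j → x i ≠ x j :=
    ae_all_iff.2 fun i => ae_all_iff.2 fun j => by
      by_cases hij : i = j
      · simp [hij]
      · exact (h i j hij).mono fun x hx _ => hx
  filter_upwards [h'] with x hx i j
  exact not_imp_not.1 (hx i j)

lemma map_multCount_baseKernel (μ : ProbabilityMeasure X)
    [NullSingletonClass (μ : Measure X)] (φ : ElementFreeDist) :
    (baseKernel μ φ : Measure (ProbabilityMeasure X)).map multCount = Measure.dirac φ := by
  rw [baseKernel, ProbabilityMeasure.coe_mk, Measure.map_map measurable_multCount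
    (φ.measurable_fill μ)]
  have h : multCount ∘ φ.fill μ =ᵐ[Measure.infinitePi fun _ : φ.Entries => (μ : Measure X)]
      fun _ => φ := by
    filter_upwards [ae_injective_infinitePi (ι := φ.Entries) (μ : Measure X)] with x hx
    exact φ.multCount_fill μ hx
  rw [Measure.map_congr h, Measure.map_const, measure_univ, one_smul]

end AtomlessBase

/-! ### Random probability measures are determined by their moments. -/

section Moments

variable {X : Type*} [MeasurableSpace X]

lemma exists_countable_generating_piSystem (X : Type*) [m : MeasurableSpace X]
    [MeasurableSpace.CountablyGenerated X] :
    ∃ C : ℕ → Set X, IsPiSystem (range C) ∧ m = MeasurableSpace.generateFrom (range C) := by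
  set S : Set (Set X) := generateSetAlgebra (MeasurableSpace.countableGeneratingSet X)
  have hS : S.Countable :=
    countable_generateSetAlgebra (MeasurableSpace.countable_countableGeneratingSet)
  have hA : IsSetAlgebra S := isSetAlgebra_generateSetAlgebra
  obtain ⟨C, hC⟩ := hS.exists_eq_range ⟨∅, hA.empty_mem⟩
  refine ⟨C, hC ▸ fun s hs t ht _ => hA.inter_mem hs ht, ?_⟩
  rw [← hC, generateFrom_generateSetAlgebra_eq,
    MeasurableSpace.generateFrom_countableGeneratingSet]

/-- The masses of a sequence of sets, as a point of the Hilbert cube. -/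
noncomputable def masses (C : ℕ → Set X) (ν : ProbabilityMeasure X) : ℕ → unitInterval :=
  fun n => ⟨(ν : Measure X).real (C n), measureReal_nonneg, measureReal_le_one⟩

lemma measurable_masses {C : ℕ → Set X} (hC : ∀ n, MeasurableSet (C n)) :
    Measurable (masses C) :=
  measurable_pi_lambda _ fun n => Measurable.subtype_mk <| ENNReal.measurable_toReal.comp <|
    (Measure.measurable_coe (hC n)).comp measurable_subtype_coe

lemma measurable_of_masses {C : ℕ → Set X} (hpi : IsPiSystem (range C))
    (hgen : (inferInstance : MeasurableSpace X) = MeasurableSpace.generateFrom (range C))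
    {α : Type*} [MeasurableSpace α] {f : α → ProbabilityMeasure X}
    (hf : Measurable fun a => masses C (f a)) : Measurable f := by
  refine Measurable.subtype_mk (f := fun a => (f a : Measure X)) (h := fun a => (f a).2) ?_
  refine Measurable.measure_of_isPiSystem_of_isProbabilityMeasure hgen hpi ?_
  rintro _ ⟨n, rfl⟩
  have : (fun a => (f a : Measure X) (C n)) = fun a => ENNReal.ofReal (masses C (f a) n) := by
    ext a
    simp [masses]
  rw [this]
  exact ENNReal.measurable_ofReal.comp
    (measurable_subtype_coe.comp ((measurable_pi_apply n).comp hf))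

/-- The coordinates separate points, so the algebra they generate determines a probability measure.
It is spanned by monomials in the coordinates. -/
lemma MeasureTheory.ext_of_forall_integral_prod_eq {P Q : Measure (ℕ → unitInterval)}
    [IsProbabilityMeasure P] [IsProbabilityMeasure Q]
    (h : ∀ (n : ℕ) (k : Fin n → ℕ), ∫ y, ∏ i, (y (k i) : ℝ) ∂P = ∫ y, ∏ i, (y (k i) : ℝ) ∂Q) :
    P = Q := by
  let c (n : ℕ) : BoundedContinuousFunction (ℕ → unitInterval) ℝ :=
    BoundedContinuousFunction.mkOfCompact ⟨fun y => (y n : ℝ), by fun_prop⟩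
  let A : StarSubalgebra ℝ (BoundedContinuousFunction (ℕ → unitInterval) ℝ) :=
    { Algebra.adjoin ℝ (range c) with star_mem' := fun {a} ha => by simpa using! ha }
  have hc (n : ℕ) : c n ∈ A := Algebra.subset_adjoin (mem_range_self n)
  refine ext_of_forall_mem_subalgebra_integral_eq_of_polish (𝕜 := ℝ) (A := A) ?_ ?_
  · intro y z hyz
    obtain ⟨n, hn⟩ := Function.ne_iff.1 hyz
    refine ⟨c n, ⟨_, ⟨c n, hc n, rfl⟩, rfl⟩, fun h => hn (Subtype.ext h)⟩
  · intro g hg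
    have hg' : g ∈ Submodule.span ℝ
        (Submonoid.closure (range c) : Set (BoundedContinuousFunction (ℕ → unitInterval) ℝ)) := by
      rw [← Algebra.adjoin_eq_span]
      exact hg
    clear hg
    induction hg' using Submodule.span_induction with
    | mem g hg =>
      obtain ⟨l, hl, rfl⟩ := Submonoid.exists_list_of_mem_closure hg
      have hk (i : Fin l.length) : ∃ k, c k = l[i] := hl _ (by simp)
      choose k hk using hk
      have hval (y : ℕ → unitInterval) : l.prod y = ∏ i, (y (k i) : ℝ) := by
        rw [← Fin.prod_univ_getElem, BoundedContinuousFunction.coe_prod, Finset.prod_apply]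
        refine Finset.prod_congr rfl fun i _ => ?_
        exact (congrArg (fun f : BoundedContinuousFunction _ ℝ => f y) (hk i)).symm
      simp_rw [hval]
      exact h _ k
    | zero => simp
    | add f g _ _ hf hg' =>
      simp only [BoundedContinuousFunction.coe_add, Pi.add_apply]
      rw [integral_add (f.integrable _) (g.integrable _),
        integral_add (f.integrable _) (g.integrable _), hf, hg']
    | smul a f _ hf =>
      simp only [BoundedContinuousFunction.coe_smul]
      rw [integral_smul, integral_smul, hf]

/-- The masses of a countable generating π-system embed the problem in the Hilbert cube, where mixed
moments determine a law. -/
theorem MeasureTheory.ProbabilityMeasure.ext_of_forall_lintegral_prod_eq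
    [MeasurableSpace.CountablyGenerated X] {P Q : ProbabilityMeasure (ProbabilityMeasure X)}
    (h : ∀ (n : ℕ) (A : Fin n → Set X), (∀ i, MeasurableSet (A i)) →
      ∫⁻ ν : ProbabilityMeasure X, ∏ i, (ν : Measure X) (A i) ∂(P : Measure _) =
        ∫⁻ ν : ProbabilityMeasure X, ∏ i, (ν : Measure X) (A i) ∂(Q : Measure _)) :
    P = Q := by
  obtain ⟨C, hpi, hgen⟩ := exists_countable_generating_piSystem X
  have hC (n : ℕ) : MeasurableSet (C n) := by
    rw [hgen]
    exact MeasurableSpace.measurableSet_generateFrom (mem_range_self n)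
  have hm := measurable_masses hC
  have hP (P : ProbabilityMeasure (ProbabilityMeasure X)) (n : ℕ) (k : Fin n → ℕ) :
      ∫ y, ∏ i, (y (k i) : ℝ) ∂((P : Measure _).map (masses C)) =
        (∫⁻ ν : ProbabilityMeasure X, ∏ i, (ν : Measure X) (C (k i)) ∂(P : Measure _)).toReal := by
    rw [integral_map hm.aemeasurable
      (Continuous.aestronglyMeasurable (by fun_prop)), ← integral_toReal]
    · refine integral_congr_ae (.of_forall fun ν => ?_)
      simp [masses, ENNReal.toReal_prod, measureReal_def]
    · exact (Finset.measurable_fun_prod _ fun i _ =>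
        (Measure.measurable_coe (hC (k i))).comp measurable_subtype_coe).aemeasurable
    · refine .of_forall fun ν => ENNReal.prod_lt_top fun i _ => measure_lt_top _ _
  have hmap : (P : Measure _).map (masses C) = (Q : Measure _).map (masses C) := by
    have := Measure.isProbabilityMeasure_map (μ := (P : Measure _)) hm.aemeasurable
    have := Measure.isProbabilityMeasure_map (μ := (Q : Measure _)) hm.aemeasurable
    refine MeasureTheory.ext_of_forall_integral_prod_eq fun n k => ?_
    rw [hP, hP, h n _ fun i => hC (k i)]
  refine Subtype.ext (Measure.ext fun S hS => ?_)
  -- Applied to the identity with the σ-algebra pulled back along `masses C`, this says that every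
  -- measurable `S` is a preimage under `masses C`.
  obtain ⟨T, hT, hTS⟩ := @measurable_of_masses _ _ C hpi hgen _
    (MeasurableSpace.comap (masses C) inferInstance) id (comap_measurable _) S hS
  rw [preimage_id] at hTS
  rw [← hTS, ← Measure.map_apply hm hT, ← Measure.map_apply hm hT]
  exact congrArg (fun μ => μ T) hmap

end Moments

/-! ### Independent labels attached to points. -/

section Labels

variable {α β γ T ι : Type*} [MeasurableSpace T] (lam : Measure T) [IsProbabilityMeasure lam]

/-- The law of `i ↦ θ (x i)` for a family `θ` of independent labels with law `lam`. -/
noncomputable def labelLaw (x : ι → α) : Measure (ι → T) :=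
  (Measure.infinitePi fun _ : α => lam).map fun θ i => θ (x i)

lemma labelLaw_comp {f : γ → α} (hf : Function.Injective f) (z : ι → γ) :
    labelLaw lam (fun i => f (z i)) = labelLaw lam z := by
  have h : (Measure.infinitePi fun _ : α => lam).map (fun θ c => θ (f c)) =
      Measure.infinitePi fun _ : γ => lam := Measure.map_infinitePi_infinitePi_of_inj hf
  rw [labelLaw, labelLaw, ← h, Measure.map_map (by fun_prop) (by fun_prop)]
  rfl

/-- Both families factor through the set of pairs `(x i, y i)`, which by hypothesis projects
injectively to each side. -/
lemma labelLaw_congr {x : ι → α} {y : ι → β} (h : ∀ i j, x i = x j ↔ y i = y j) :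
    labelLaw lam x = labelLaw lam y := by
  let z : ι → range fun i => (x i, y i) := fun i => ⟨(x i, y i), i, rfl⟩
  have h1 : Function.Injective fun c : range fun i => (x i, y i) => c.1.1 := by
    rintro ⟨_, i, rfl⟩ ⟨_, j, rfl⟩ hij
    exact Subtype.ext (Prod.ext hij ((h i j).1 hij))
  have h2 : Function.Injective fun c : range fun i => (x i, y i) => c.1.2 := by
    rintro ⟨_, i, rfl⟩ ⟨_, j, rfl⟩ hij
    exact Subtype.ext (Prod.ext ((h i j).2 hij) hij)
  exact (labelLaw_comp lam h1 z).trans (labelLaw_comp lam h2 z).symm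

/-- If labels are translated by amounts depending on the point only, their joint law does not
change. -/
lemma map_add_label_eq_labelLaw [AddCommGroup T] [MeasurableAdd T] [lam.IsAddLeftInvariant]
    {x : ι → α} (c : α → β) (s : α → T) (h : ∀ i j, x i ≠ x j → c (x i) ≠ c (x j)) :
    (Measure.infinitePi fun _ : β => lam).map (fun θ i => s (x i) + θ (c (x i))) =
      labelLaw lam x := by
  classical
  have hpat (i j : ι) : x i = x j ↔ c (x i) = c (x j) :=
    ⟨fun hij => by rw [hij], not_imp_not.1 (h i j)⟩
  -- Each used cell `b` contains only one point among the `x i`, so the translation can be read off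
  -- from the cell. It is `0` on unused cells. Invariance of `lam` then absorbs it.
  let τ : β → T := fun b => if hb : ∃ i, c (x i) = b then s (x hb.choose) else 0
  have hτ (i : ι) : τ (c (x i)) = s (x i) := by
    have hi : ∃ j, c (x j) = c (x i) := ⟨i, rfl⟩
    simp only [τ, dif_pos hi]
    rw [(hpat _ _).2 hi.choose_spec]
  have hinv : (Measure.infinitePi fun _ : β => lam).map (fun θ b => τ b + θ b) =
      Measure.infinitePi fun _ : β => lam := by
    rw [Measure.infinitePi_map_pi (f := fun b t => τ b + t) _ fun b => measurable_const_add (τ b)]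
    simp_rw [map_add_left_eq_self]
  rw [labelLaw_congr lam hpat, labelLaw]
  conv_rhs => rw [← hinv]
  rw [Measure.map_map (by fun_prop)
    (measurable_pi_lambda _ fun b => (measurable_pi_apply b).const_add (τ b))]
  congr 1
  ext θ i
  simp [hτ]

end Labels

/-! ### Wrapping the interval around the circle with random rotations. -/

section BlockMap

/-- Stretch the unit interval `N` times around the circle, rotating the `j`-th lap by `θ j`. -/
noncomputable def blockMap (N : ℕ) (θ : ℕ → UnitAddCircle) (x : unitInterval) : UnitAddCircle :=
  ((N * x : ℝ) : UnitAddCircle) + θ ⌈(N * x : ℝ)⌉₊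

instance : IsProbabilityMeasure (volume : Measure UnitAddCircle) := ⟨UnitAddCircle.measure_univ⟩

lemma measurable_blockMap (N : ℕ) :
    Measurable fun p : (ℕ → UnitAddCircle) × unitInterval => blockMap N p.1 p.2 := by
  have h : Measurable fun p : (ℕ → UnitAddCircle) × ℕ => p.1 p.2 :=
    measurable_from_prod_countable_left fun n => measurable_pi_apply n
  have hx : Measurable fun p : (ℕ → UnitAddCircle) × unitInterval => (N * p.2 : ℝ) := by fun_prop
  exact (AddCircle.measurable_mk'.comp hx).add
    (h.comp (measurable_fst.prodMk (Nat.measurable_ceil.comp hx)))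

/-- Induction on the laps: each lap covers the circle once, and its rotation preserves volume. -/
lemma volume_Ioc_inter_coe_add_mem (N : ℕ) (θ : ℕ → UnitAddCircle) {A : Set UnitAddCircle}
    (hA : MeasurableSet A) :
    volume (Ioc (0 : ℝ) N ∩ {y : ℝ | (y : UnitAddCircle) + θ ⌈y⌉₊ ∈ A}) = N * volume A := by
  induction N with
  | zero => simp
  | succ N ih =>
    have hsplit : Ioc (0 : ℝ) (N + 1 : ℕ) = Ioc 0 (N : ℝ) ∪ Ioc (N : ℝ) (N + 1) := by
      rw [Nat.cast_succ, Ioc_union_Ioc_eq_Ioc (Nat.cast_nonneg N) (by linarith)]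
    have hlap : Ioc (N : ℝ) (N + 1) ∩ {y : ℝ | (y : UnitAddCircle) + θ ⌈y⌉₊ ∈ A} =
        (fun y : ℝ => (y : UnitAddCircle)) ⁻¹' ((fun u => u + θ (N + 1)) ⁻¹' A) ∩
          Ioc (N : ℝ) (N + 1) := by
      ext y
      simp only [mem_inter_iff, mem_ofPred_eq, mem_preimage, and_comm (a := y ∈ Ioc _ _)]
      refine and_congr_left fun hy => ?_
      -- On `(N, N + 1]` the ceiling is constantly `N + 1`.
      rw [(Nat.ceil_eq_iff N.succ_ne_zero).2 (by simpa using hy)]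
    have hA' : MeasurableSet ((fun u => u + θ (N + 1)) ⁻¹' A) := measurable_add_const _ hA
    have hlap' : volume (Ioc (N : ℝ) (N + 1) ∩ {y : ℝ | (y : UnitAddCircle) + θ ⌈y⌉₊ ∈ A}) =
        volume A := by
      rw [hlap, ← Measure.restrict_apply (AddCircle.measurable_mk' hA'),
        (UnitAddCircle.measurePreserving_mk (N : ℝ)).measure_preimage hA'.nullMeasurableSet,
        measure_preimage_add_right]
    rw [hsplit, union_inter_distrib_right, measure_union' _ _, ih, hlap']
    · push_cast; ring
    · exact (Ioc_disjoint_Ioc_of_le le_rfl).mono inter_subset_left inter_subset_left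
    · refine measurableSet_Ioc.inter ?_
      have h : Measurable fun y : ℝ => (y : UnitAddCircle) + θ ⌈y⌉₊ :=
        AddCircle.measurable_mk'.add ((measurable_from_top (f := θ)).comp Nat.measurable_ceil)
      exact h hA

lemma map_blockMap {N : ℕ} (hN : N ≠ 0) (θ : ℕ → UnitAddCircle) :
    (volume : Measure unitInterval).map (blockMap N θ) = volume := by
  have hm : Measurable (blockMap N θ) := (measurable_blockMap N).comp measurable_prodMk_left
  ext A hA
  rw [Measure.map_apply hm hA]
  set S : Set ℝ := {y : ℝ | (y : UnitAddCircle) + θ ⌈y⌉₊ ∈ A}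
  have hS : MeasurableSet S := by
    have h : Measurable fun y : ℝ => (y : UnitAddCircle) + θ ⌈y⌉₊ :=
      AddCircle.measurable_mk'.add ((measurable_from_top (f := θ)).comp Nat.measurable_ceil)
    exact h hA
  have hmul : Measurable fun x : ℝ => (N : ℝ) * x := measurable_const_mul _
  have h1 : blockMap N θ ⁻¹' A = Subtype.val ⁻¹' ((fun x : ℝ => (N : ℝ) * x) ⁻¹' S) := rfl
  have h2 : volume (Subtype.val ⁻¹' ((fun x : ℝ => (N : ℝ) * x) ⁻¹' S) : Set unitInterval) =
      volume.restrict (Icc (0 : ℝ) 1) ((fun x : ℝ => (N : ℝ) * x) ⁻¹' S) :=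
    (measurePreserving_subtype_coe (μa := volume) measurableSet_Icc).measure_preimage
      (hmul hS).nullMeasurableSet
  have hN' : (0 : ℝ) < N := by positivity
  have h3 : (fun x : ℝ => (N : ℝ) * x) ⁻¹' S ∩ Ioc 0 1 =
      (fun x : ℝ => (N : ℝ) * x) ⁻¹' (Ioc (0 : ℝ) N ∩ S) := by
    ext x
    simp only [mem_inter_iff, mem_preimage, mem_Ioc, and_comm (b := (N : ℝ) * x ∈ S)]
    rw [mul_pos_iff_of_pos_left hN', mul_le_iff_le_one_right hN']
  -- The endpoint `0`, the only point with lap index `0`, is null and is dropped.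
  rw [h1, h2, ← restrict_Ioc_eq_restrict_Icc, Measure.restrict_apply (hmul hS), h3,
    Real.volume_preimage_mul_left hN'.ne', volume_Ioc_inter_coe_add_mem N θ hA, ← mul_assoc,
    abs_of_pos (by positivity), ENNReal.ofReal_inv_of_pos hN', ENNReal.ofReal_natCast,
    ENNReal.inv_mul_cancel (by simpa using hN) (by simp), one_mul]

lemma eventually_ceil_mul_ne {x y : unitInterval} (h : x ≠ y) :
    ∀ᶠ N : ℕ in atTop, ⌈(N * x : ℝ)⌉₊ ≠ ⌈(N * y : ℝ)⌉₊ := by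
  wlog hxy : x < y generalizing x y
  · exact (this h.symm (lt_of_le_of_ne (not_lt.1 hxy) h.symm)).mono fun _ => Ne.symm
  have hpos : (0 : ℝ) < y - x := sub_pos.2 hxy
  obtain ⟨N₀, hN₀⟩ := exists_nat_gt (1 / ((y : ℝ) - x))
  filter_upwards [eventually_ge_atTop N₀] with N hN heq
  have h1 : 1 < N * ((y : ℝ) - x) := by
    rw [div_lt_iff₀ hpos] at hN₀
    exact hN₀.trans_le (by gcongr)
  have h2 := Nat.ceil_lt_add_one (a := (N * x : ℝ)) (mul_nonneg N.cast_nonneg x.2.1)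
  have h3 := Nat.le_ceil (N * y : ℝ)
  rw [heq] at h2
  linarith

end BlockMap

/-! ### Moments as averages of label probabilities. -/

section MomentFormula

variable {n : ℕ} (A : Fin n → Set UnitAddCircle)

/-- The probability that independent uniform labels of the points `x i` lie in the sets `A i`. -/
noncomputable def labelProb (x : Fin n → unitInterval) : ℝ≥0∞ :=
  labelLaw (volume : Measure UnitAddCircle) x (univ.pi A)

/-- The analogue of `labelProb` for the labels given by the random maps `blockMap N`. -/
noncomputable def blockProb (N : ℕ) (x : Fin n → unitInterval) : ℝ≥0∞ :=
  (Measure.infinitePi fun _ : ℕ => (volume : Measure UnitAddCircle))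
    {θ | ∀ i, blockMap N θ (x i) ∈ A i}

variable {A}

lemma measurableSet_blockMap_mem (hA : ∀ i, MeasurableSet (A i)) (N : ℕ) :
    MeasurableSet {p : (Fin n → unitInterval) × (ℕ → UnitAddCircle) |
      ∀ i, blockMap N p.2 (p.1 i) ∈ A i} := by
  rw [ofPred_forall]
  refine MeasurableSet.iInter fun i => ?_
  have : Measurable fun p : (Fin n → unitInterval) × (ℕ → UnitAddCircle) =>
      blockMap N p.2 (p.1 i) :=
    (measurable_blockMap N).comp
      (measurable_snd.prodMk ((measurable_pi_apply i).comp measurable_fst))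
  exact this (hA i)

lemma measurable_blockProb (hA : ∀ i, MeasurableSet (A i)) (N : ℕ) :
    Measurable (blockProb A N) :=
  measurable_measure_prodMk_left (measurableSet_blockMap_mem hA N)

/-- The sequence is eventually constant: once distinct sample points lie on different laps, their
rotations are independent, and the offsets `N * x i` are absorbed by invariance. -/
lemma tendsto_blockProb (hA : ∀ i, MeasurableSet (A i)) (x : Fin n → unitInterval) :
    Tendsto (fun N => blockProb A N x) atTop (𝓝 (labelProb A x)) := by
  have h : ∀ᶠ N : ℕ in atTop, ∀ i j, x i ≠ x j → ⌈(N * x i : ℝ)⌉₊ ≠ ⌈(N * x j : ℝ)⌉₊ :=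
    eventually_all.2 fun i => eventually_all.2 fun j => by
      by_cases hij : x i = x j
      · simp [hij]
      · exact (eventually_ceil_mul_ne hij).mono fun _ hN _ => hN
  refine tendsto_const_nhds.congr' (h.mono fun N hN => ?_)
  rw [labelProb, ← map_add_label_eq_labelLaw volume
    (fun y : unitInterval => ⌈(N * y : ℝ)⌉₊)
    (fun y : unitInterval => ((N * y : ℝ) : UnitAddCircle)) hN,
    Measure.map_apply (by fun_prop) (.univ_pi hA)]
  refine congrArg _ (Eq.symm ?_)
  ext θ
  simp [blockMap]

lemma measurable_labelProb (hA : ∀ i, MeasurableSet (A i)) : Measurable (labelProb A) :=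
  measurable_of_tendsto_metrizable (measurable_blockProb hA)
    (tendsto_pi_nhds.2 fun x => tendsto_blockProb hA x)

lemma labelProb_congr {x y : Fin n → unitInterval} (h : ∀ i j, x i = x j ↔ y i = y j) :
    labelProb A x = labelProb A y := by
  rw [labelProb, labelProb, labelLaw_congr volume h]

lemma iidKernel_univ_pi {X : Type*} [MeasurableSpace X] {ν : ProbabilityMeasure X}
    {B : Fin n → Set X} (hB : ∀ i, MeasurableSet (B i)) :
    iidKernel (Fin n) X ν (univ.pi B) = ∏ i, (ν : Measure X) (B i) := by
  have := Measure.infinitePi_pi (fun _ : Fin n => (ν : Measure X)) (s := Finset.univ)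
    fun i _ => hB i
  rwa [Finset.coe_univ] at this

/-- If all the maps `blockMap N θ` push `P` forward to `Q`, then the moments of `Q` are
averages of label probabilities. -/
lemma lintegral_prod_eq_lintegral_labelProb
    {P : ProbabilityMeasure (ProbabilityMeasure unitInterval)}
    {Q : ProbabilityMeasure (ProbabilityMeasure UnitAddCircle)}
    (hPQ : ∀ (N : ℕ) (θ : ℕ → UnitAddCircle) (hf : Measurable (blockMap N θ)), N ≠ 0 →
      (Q : Measure (ProbabilityMeasure UnitAddCircle)) =
        (P : Measure (ProbabilityMeasure unitInterval)).map fun ν => ν.map hf.aemeasurable)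
    (hA : ∀ i, MeasurableSet (A i)) :
    ∫⁻ ν : ProbabilityMeasure UnitAddCircle, ∏ i, (ν : Measure UnitAddCircle) (A i)
        ∂(Q : Measure (ProbabilityMeasure UnitAddCircle)) =
      ∫⁻ ν : ProbabilityMeasure unitInterval, ∫⁻ x, labelProb A x ∂(iidKernel (Fin n) unitInterval ν)
        ∂(P : Measure (ProbabilityMeasure unitInterval)) := by
  -- The law of `n` points drawn independently from a random `ν ∼ P`.
  set M : Measure (Fin n → unitInterval) :=
    (P : Measure (ProbabilityMeasure unitInterval)).bind (iidKernel (Fin n) unitInterval)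
  have hprod {X : Type} [MeasurableSpace X] {B : Fin n → Set X} (hB : ∀ i, MeasurableSet (B i)) :
      Measurable fun ν : ProbabilityMeasure X => ∏ i, (ν : Measure X) (B i) :=
    Finset.measurable_fun_prod _ fun i _ =>
      (Measure.measurable_coe (hB i)).comp measurable_subtype_coe
  have h1 (N : ℕ) (hN : N ≠ 0) (θ : ℕ → UnitAddCircle) :
      ∫⁻ ν : ProbabilityMeasure UnitAddCircle, ∏ i, (ν : Measure UnitAddCircle) (A i)
        ∂(Q : Measure (ProbabilityMeasure UnitAddCircle)) =
      M {x | ∀ i, blockMap N θ (x i) ∈ A i} := by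
    have hf : Measurable (blockMap N θ) := (measurable_blockMap N).comp measurable_prodMk_left
    have hset : {x : Fin n → unitInterval | ∀ i, blockMap N θ (x i) ∈ A i} =
        univ.pi fun i => blockMap N θ ⁻¹' A i := by
      ext x
      simp
    rw [hPQ N θ hf hN, lintegral_map (hprod hA) (ProbabilityMeasure.measurable_map hf), hset,
      Measure.bind_apply (.univ_pi fun i => hf (hA i)) (Kernel.aemeasurable _)]
    refine lintegral_congr fun ν => ?_
    rw [iidKernel_univ_pi fun i => hf (hA i)]
    refine Finset.prod_congr rfl fun i _ => ?_
    exact Measure.map_apply hf (hA i)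
  -- The moment is the same for every `θ`, so averaging over `θ` leaves it unchanged. Fubini then
  -- moves this average inside.
  have h2 (N : ℕ) (hN : N ≠ 0) :
      ∫⁻ ν : ProbabilityMeasure UnitAddCircle, ∏ i, (ν : Measure UnitAddCircle) (A i)
        ∂(Q : Measure (ProbabilityMeasure UnitAddCircle)) = ∫⁻ x, blockProb A N x ∂M := by
    have hS := measurableSet_blockMap_mem hA N
    have e1 := Measure.prod_apply (μ := M)
      (ν := Measure.infinitePi fun _ : ℕ => (volume : Measure UnitAddCircle)) hS
    rw [Measure.prod_apply_symm hS] at e1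
    refine Eq.trans ?_ e1
    have e2 (θ : ℕ → UnitAddCircle) := (h1 N hN θ).symm
    refine Eq.trans ?_ (lintegral_congr e2).symm
    rw [lintegral_const, measure_univ, mul_one]
  have hlim : Tendsto (fun N => ∫⁻ x, blockProb A N x ∂M) atTop (𝓝 (∫⁻ x, labelProb A x ∂M)) :=
    tendsto_lintegral_of_dominated_convergence (fun _ => 1) (measurable_blockProb hA)
      (fun N => .of_forall fun x => prob_le_one) (by simp)
      (.of_forall fun x => tendsto_blockProb hA x)
  have hconst := tendsto_nhds_unique hlim (tendsto_const_nhds.congr'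
    ((eventually_ne_atTop 0).mono fun N hN => h2 N hN))
  rw [← hconst, Measure.lintegral_bind (Kernel.aemeasurable _)
    (measurable_labelProb hA).aemeasurable]

end MomentFormula

/-! ### Couplings that match atoms. -/

section Coupling

variable {X Y ι : Type*} [MeasurableSpace X] [MeasurableSpace Y]

/-- Two probability measures admit a coupling that identifies their atoms. -/
def HasAtomCoupling (ν : ProbabilityMeasure X) (ν' : ProbabilityMeasure Y) : Prop :=
  ∃ ρ : Measure (X × Y), ρ.map Prod.fst = ν ∧ ρ.map Prod.snd = ν' ∧
    ∀ᵐ z ∂(ρ.prod ρ), z.1.1 = z.2.1 ↔ z.1.2 = z.2.2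

/-- Sampling independently from the coupling gives i.i.d. samples of both laws which almost surely
have the same equality pattern. -/
lemma HasAtomCoupling.lintegral_eq [Countable ι] {ν : ProbabilityMeasure X}
    {ν' : ProbabilityMeasure Y} (h : HasAtomCoupling ν ν') {k : (ι → X) → ℝ≥0∞}
    {k' : (ι → Y) → ℝ≥0∞} (hk : Measurable k) (hk' : Measurable k')
    (hkk' : ∀ x y, (∀ i j, x i = x j ↔ y i = y j) → k x = k' y) :
    ∫⁻ x, k x ∂(iidKernel ι X ν) = ∫⁻ y, k' y ∂(iidKernel ι Y ν') := by
  obtain ⟨ρ, h1, h2, hρ⟩ := h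
  have : IsProbabilityMeasure ρ := by
    refine ⟨?_⟩
    rw [← measure_univ (μ := (ν : Measure X)), ← h1, Measure.map_apply measurable_fst .univ,
      preimage_univ]
  have e1 : (Measure.infinitePi fun _ : ι => ρ).map (fun z i => (z i).1) = iidKernel ι X ν := by
    rw [Measure.infinitePi_map_pi (f := fun _ => Prod.fst) _ fun _ => measurable_fst]
    simp_rw [h1]
    rfl
  have e2 : (Measure.infinitePi fun _ : ι => ρ).map (fun z i => (z i).2) = iidKernel ι Y ν' := by
    rw [Measure.infinitePi_map_pi (f := fun _ => Prod.snd) _ fun _ => measurable_snd]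
    simp_rw [h2]
    rfl
  rw [← e1, ← e2, lintegral_map hk (by fun_prop), lintegral_map hk' (by fun_prop)]
  refine lintegral_congr_ae ?_
  have hall : ∀ᵐ z ∂(Measure.infinitePi fun _ : ι => ρ), ∀ i j,
      (z i).1 = (z j).1 ↔ (z i).2 = (z j).2 :=
    ae_all_iff.2 fun i => ae_all_iff.2 fun j => by
      by_cases hij : i = j
      · simp [hij]
      · rw [← Measure.infinitePi_map_eval_prod (P := fun _ : ι => ρ) hij] at hρ
        exact ae_of_ae_map (f := fun z : ι → X × Y => (z i, z j)) (by fun_prop) hρ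
  filter_upwards [hall] with z hz using hkk' _ _ hz

lemma restrict_add_alloc_eq [MeasurableSingletonClass X] (ν : ProbabilityMeasure X)
    {a : (multCount ν).Entries → X} (ha : Function.Injective a)
    (haν : ∀ s, (ν : Measure X) {a s} = ENNReal.ofReal (s.1 : ℝ))
    (hsurj : ∀ y, (ν : Measure X) {y} ≠ 0 → ∃ s, a s = y) :
    (ν : Measure X).restrict {x | (ν : Measure X) {x} = 0} + (multCount ν).alloc a = ν := by
  set S : Set X := {x | (ν : Measure X) {x} = 0}
  have hSc : Sᶜ = range a := by
    ext y
    refine ⟨hsurj y, ?_⟩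
    rintro ⟨s, rfl⟩
    have := s.1.2.1
    simpa [S, haν] using this
  have hcount : (range a).Countable := countable_range a
  have hS : MeasurableSet S := by
    rw [← compl_compl S, hSc]
    exact hcount.measurableSet.compl
  ext B hB
  have h := (lintegral_countable (μ := (ν : Measure X)) (B.indicator 1) hcount)
  rw [lintegral_indicator_one hB, Measure.restrict_apply hB,
    ← (Equiv.ofInjective a ha).tsum_eq (fun y : range a =>
      B.indicator 1 (y : X) * (ν : Measure X) {(y : X)})] at h
  rw [Measure.add_apply, Measure.restrict_apply hB, ElementFreeDist.alloc,
    Measure.sum_apply _ hB, ← measure_inter_add_sdiff (μ := (ν : Measure X)) B hS]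
  congr 1
  rw [sdiff_eq, hSc, h]
  refine tsum_congr fun s => ?_
  rw [Measure.smul_apply, Measure.dirac_apply' _ hB, Equiv.ofInjective_apply, haν, smul_eq_mul,
    mul_comm]

end Coupling

section CouplingFill

variable {X Y : Type*} [MeasurableSpace X] [MeasurableEq X] [MeasurableSpace Y] [MeasurableEq Y]

/-- The atom `a s` is matched with the point `y s` of equal weight, while the diffuse part of `ν` is
coupled independently with `μ`. Both diffuse parts have mass `1 - totalWeight`. -/
lemma hasAtomCoupling_fill (ν : ProbabilityMeasure X) (μ : ProbabilityMeasure Y)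
    [NullSingletonClass (μ : Measure Y)] {y : (multCount ν).Entries → Y}
    (hy : Function.Injective y) : HasAtomCoupling ν ((multCount ν).fill μ y) := by
  obtain ⟨a, ha, haν, hsurj⟩ := exists_enumeration_atoms ν
  have hsum := restrict_add_alloc_eq ν ha haν hsurj
  set S : Set X := {x | (ν : Measure X) {x} = 0}
  have hS : MeasurableSet S := by
    have : S = (range a)ᶜ := by
      ext x
      simp only [S, mem_ofPred_eq, mem_compl_iff, mem_range]
      refine ⟨?_, fun hx => by_contra fun h0 => hx (hsurj x h0)⟩
      rintro h0 ⟨s, rfl⟩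
      have := s.1.2.1
      simp only [haν, ENNReal.ofReal_eq_zero] at h0
      linarith
    rw [this]
    exact (countable_range a).measurableSet.compl
  have hmass : (ν : Measure X) S = 1 - (multCount ν).totalWeight := by
    have h := congrArg (fun m : Measure X => m univ) hsum
    simp only [Measure.add_apply, Measure.restrict_apply_univ, (multCount ν).alloc_univ, measure_univ] at h
    refine ENNReal.eq_sub_of_add_eq ?_ h
    exact ne_top_of_le_ne_top ENNReal.one_ne_top (multCount ν).tsum_le_one
  set ρ : Measure (X × Y) := ((ν : Measure X).restrict S).prod μ + (multCount ν).alloc fun s => (a s, y s)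
  have halloc {B : Set (X × Y)} (hB : MeasurableSet B) : (multCount ν).alloc (fun s => (a s, y s)) B =
      ∑' s : (multCount ν).Entries, ENNReal.ofReal (s.1 : ℝ) * B.indicator 1 (a s, y s) := by
    simp [ElementFreeDist.alloc, Measure.sum_apply _ hB, Measure.dirac_apply' _ hB]
  have hfst : ρ.map Prod.fst = ν := by
    rw [← hsum]
    ext B hB
    rw [Measure.map_apply measurable_fst hB, Measure.add_apply, halloc (measurable_fst hB),
      Measure.add_apply, ← prod_univ, Measure.prod_prod, measure_univ, mul_one]
    congr 1
    rw [prod_univ, ElementFreeDist.alloc, Measure.sum_apply _ hB]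
    refine tsum_congr fun s => ?_
    rw [Measure.smul_apply, Measure.dirac_apply' _ hB, smul_eq_mul]
    rfl
  have hsnd : ρ.map Prod.snd = (multCount ν).fill μ y := by
    ext B hB
    rw [Measure.map_apply measurable_snd hB, Measure.add_apply, halloc (measurable_snd hB),
      ElementFreeDist.fill, ProbabilityMeasure.coe_mk, Measure.add_apply, Measure.smul_apply,
      ← univ_prod, Measure.prod_prod, Measure.restrict_apply_univ, hmass, smul_eq_mul]
    congr 1
    rw [univ_prod, ElementFreeDist.alloc, Measure.sum_apply _ hB]
    refine tsum_congr fun s => ?_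
    rw [Measure.smul_apply, Measure.dirac_apply' _ hB, smul_eq_mul]
    rfl
  refine ⟨ρ, hfst, hsnd, ?_⟩
  have hρ : IsProbabilityMeasure ρ := by
    refine ⟨?_⟩
    rw [← measure_univ (μ := (ν : Measure X)), ← hfst, Measure.map_apply measurable_fst .univ,
      preimage_univ]
  -- A draw is either a matched pair of atoms, or both of its coordinates are non-atoms, which an
  -- independent draw almost surely misses.
  have hgood : ∀ᵐ z ∂ρ, (∃ s, z = (a s, y s)) ∨
      ((ν : Measure X) {z.1} = 0 ∧ ∀ s, y s ≠ z.2) := by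
    rw [ae_add_measure_iff]
    constructor
    · have h1 : ∀ᵐ z ∂((ν : Measure X).restrict S).prod (μ : Measure Y), z.1 ∈ S :=
        Measure.quasiMeasurePreserving_fst.ae (ae_restrict_mem hS)
      have h2 : ∀ᵐ z ∂((ν : Measure X).restrict S).prod (μ : Measure Y), z.2 ∉ range y :=
        Measure.quasiMeasurePreserving_snd.ae ((countable_range y).ae_notMem _)
      filter_upwards [h1, h2] with z hz1 hz2
      exact .inr ⟨hz1, fun s hs => hz2 ⟨s, hs⟩⟩
    · rw [ElementFreeDist.alloc, Measure.ae_sum_iff]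
      intro s
      refine Measure.ae_smul_measure ?_ _
      rw [ae_dirac_eq]
      exact .inl ⟨s, rfl⟩
  have hmeas : MeasurableSet {z : (X × Y) × (X × Y) | z.1.1 = z.2.1 ↔ z.1.2 = z.2.2} :=
    (measurableSet_eq_fun measurable_fst.fst measurable_snd.fst).iff
      (measurableSet_eq_fun measurable_fst.snd measurable_snd.snd)
  rw [Measure.ae_prod_iff_ae_ae hmeas]
  filter_upwards [hgood] with z hz
  rcases hz with ⟨s, rfl⟩ | ⟨hz1, hz2⟩
  · filter_upwards [hgood] with z' hz'
    rcases hz' with ⟨t, rfl⟩ | ⟨hz1, hz2⟩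
    · simp [ha.eq_iff, hy.eq_iff]
    · refine iff_of_false (fun h => ?_) (hz2 s)
      have := s.1.2.1
      rw [← h, haν, ENNReal.ofReal_eq_zero] at hz1
      linarith
  · have h1 : ∀ᵐ x ∂(ρ.map Prod.fst), x ≠ z.1 := by
      rw [hfst]
      exact measure_eq_zero_iff_ae_notMem.1 hz1
    have h2 : ∀ᵐ x ∂(ρ.map Prod.snd), x ≠ z.2 := by
      rw [hsnd]
      exact measure_eq_zero_iff_ae_notMem.1 ((multCount ν).fill_singleton_eq_zero μ hz2)
    filter_upwards [ae_of_ae_map measurable_fst.aemeasurable h1,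
      ae_of_ae_map measurable_snd.aemeasurable h2] with z' h1' h2'
    exact iff_of_false (Ne.symm h1') (Ne.symm h2')

end CouplingFill

/-! ### Averaged label probabilities depend only on the multiplicity count. -/

section Determination

variable {n : ℕ} {A : Fin n → Set UnitAddCircle}

instance : NullSingletonClass (uniformUnit : Measure unitInterval) :=
  inferInstanceAs (NullSingletonClass (volume : Measure unitInterval))

lemma measurable_lintegral_labelProb (hA : ∀ i, MeasurableSet (A i)) :
    Measurable fun ν : ProbabilityMeasure unitInterval =>
      ∫⁻ x, labelProb A x ∂(iidKernel (Fin n) unitInterval ν) :=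
  (measurable_labelProb hA).lintegral_kernel

/-- For almost every placement of the points, the filled measure has an atom-matching coupling with
`ν`, so the inner integral is almost surely constant. -/
lemma lintegral_labelProb_eq_lintegral_baseKernel (hA : ∀ i, MeasurableSet (A i))
    (ν : ProbabilityMeasure unitInterval) :
    ∫⁻ x, labelProb A x ∂(iidKernel (Fin n) unitInterval ν) =
      ∫⁻ ν', ∫⁻ x, labelProb A x ∂(iidKernel (Fin n) unitInterval ν')
        ∂(baseKernel uniformUnit (multCount ν) : Measure (ProbabilityMeasure unitInterval)) := by
  rw [baseKernel, ProbabilityMeasure.coe_mk,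
    lintegral_map (measurable_lintegral_labelProb hA) (ElementFreeDist.measurable_fill _ _)]
  have h : ∀ᵐ y ∂(Measure.infinitePi fun _ : (multCount ν).Entries =>
      (uniformUnit : Measure unitInterval)),
      ∫⁻ x, labelProb A x
        ∂(iidKernel (Fin n) unitInterval ((multCount ν).fill uniformUnit y)) =
      ∫⁻ x, labelProb A x ∂(iidKernel (Fin n) unitInterval ν) := by
    filter_upwards [ae_injective_infinitePi (ι := (multCount ν).Entries)
      (uniformUnit : Measure unitInterval)] with y hy
    exact ((hasAtomCoupling_fill ν uniformUnit hy).lintegral_eq (measurable_labelProb hA)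
      (measurable_labelProb hA) fun _ _ => labelProb_congr).symm
  rw [lintegral_congr_ae h, lintegral_const, measure_univ, mul_one]

lemma lintegral_lintegral_labelProb_eq_map_multCount (hA : ∀ i, MeasurableSet (A i))
    (P : Measure (ProbabilityMeasure unitInterval)) :
    ∫⁻ ν, ∫⁻ x, labelProb A x ∂(iidKernel (Fin n) unitInterval ν) ∂P =
      ∫⁻ φ, ∫⁻ ν', ∫⁻ x, labelProb A x ∂(iidKernel (Fin n) unitInterval ν')
        ∂(baseKernel uniformUnit φ : Measure (ProbabilityMeasure unitInterval))
        ∂(P.map multCount) := by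
  rw [lintegral_map _ measurable_multCount]
  · exact lintegral_congr fun ν => lintegral_labelProb_eq_lintegral_baseKernel hA ν
  · exact (Measure.measurable_lintegral (measurable_lintegral_labelProb hA)).comp
      (measurable_subtype_coe.comp (measurable_baseKernel.comp measurable_prodMk_left))

end Determination

/-! ### Natural transformations are determined by the law of the multiplicity count. -/

namespace GiryNat

variable {X Y : Type} [MeasurableSpace X] [StandardBorelSpace X] [MeasurableSpace Y]
  [StandardBorelSpace Y]

lemma component_map (H : GiryNat) {f : X → Y} (hf : Measurable f) (μ : ProbabilityMeasure X) :
    (H.component Y (μ.map hf.aemeasurable) : Measure (ProbabilityMeasure Y)) =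
      (H.component X μ : Measure (ProbabilityMeasure X)).map fun ν => ν.map hf.aemeasurable := by
  let X' : Sbs := ⟨MeasCat.of X, inferInstanceAs (StandardBorelSpace X)⟩
  let Y' : Sbs := ⟨MeasCat.of Y, inferInstanceAs (StandardBorelSpace Y)⟩
  let g : X' ⟶ Y' := ⟨⟨f, hf⟩⟩
  have h := H.naturality g
  have h' := congrArg (fun k => (k.1 μ : ProbabilityMeasure (ProbabilityMeasure Y)).1) h
  exact h'

lemma ext_component {H H' : GiryNat}
    (h : ∀ (X : Type) [MeasurableSpace X] [StandardBorelSpace X] (μ : ProbabilityMeasure X),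
      H.component X μ = H'.component X μ) : H = H' := by
  refine NatTrans.ext (funext fun X => Subtype.ext (funext fun μ => ?_))
  obtain ⟨X, hX⟩ := X
  exact @h X _ hX μ

/-- The uniform distribution on the circle. -/
noncomputable def uniformCircle : ProbabilityMeasure UnitAddCircle := ⟨volume, inferInstance⟩

lemma exists_map_uniformUnit_eq (μ : ProbabilityMeasure X) :
    ∃ (f : unitInterval → X) (hf : Measurable f), μ = uniformUnit.map hf.aemeasurable := by
  have := nonempty_of_isProbabilityMeasure (μ : Measure X)
  obtain ⟨f, hf, h⟩ := Measure.exists_measurable_map_eq (μ : Measure X)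
  exact ⟨f, hf, Subtype.ext h.symm⟩

/-- The circle is cut open at one point. The choice of representative there does not matter, since
endpoints are null. -/
lemma exists_map_uniformCircle_eq_uniformUnit :
    ∃ (f : UnitAddCircle → unitInterval) (hf : Measurable f),
      uniformUnit = uniformCircle.map hf.aemeasurable := by
  have hp : Measurable (projIcc (0 : ℝ) 1 zero_le_one) := continuous_projIcc.measurable
  let f (u : UnitAddCircle) : unitInterval :=
    projIcc (0 : ℝ) 1 zero_le_one (AddCircle.measurableEquivIoc (1 : ℝ) 0 u)
  have hf : Measurable f := hp.comp
    (measurable_subtype_coe.comp (AddCircle.measurableEquivIoc (1 : ℝ) 0).measurable)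
  refine ⟨f, hf, Subtype.ext ?_⟩
  have hmk := UnitAddCircle.measurePreserving_mk 0
  have hI : (volume : Measure unitInterval).map Subtype.val = volume.restrict (Icc (0 : ℝ) 1) :=
    (measurePreserving_subtype_coe (μa := volume) measurableSet_Icc).map_eq
  have hae : f ∘ (fun y : ℝ => (y : UnitAddCircle)) =ᵐ[volume.restrict (Ioc (0 : ℝ) (0 + 1))]
      projIcc (0 : ℝ) 1 zero_le_one := by
    filter_upwards [ae_restrict_mem measurableSet_Ioc] with y hy
    exact congrArg (fun z : Ioc (0 : ℝ) (0 + 1) => projIcc (0 : ℝ) 1 zero_le_one z)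
      ((AddCircle.equivIoc (1 : ℝ) 0).apply_symm_apply ⟨y, hy⟩)
  change volume = (volume : Measure UnitAddCircle).map f
  rw [← hmk.map_eq, Measure.map_map hf hmk.measurable, Measure.map_congr hae, zero_add,
    restrict_Ioc_eq_restrict_Icc, ← hI, Measure.map_map hp measurable_subtype_coe]
  have : projIcc (0 : ℝ) 1 zero_le_one ∘ Subtype.val = id := funext fun x => projIcc_val _ x
  rw [this, Measure.map_id]

lemma component_uniformCircle_eq {H H' : GiryNat}
    (h : (H.component unitInterval uniformUnit :
        Measure (ProbabilityMeasure unitInterval)).map multCount =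
      (H'.component unitInterval uniformUnit :
        Measure (ProbabilityMeasure unitInterval)).map multCount) :
    H.component UnitAddCircle uniformCircle = H'.component UnitAddCircle uniformCircle := by
  have hblock (N : ℕ) (θ : ℕ → UnitAddCircle) (hf : Measurable (blockMap N θ)) (hN : N ≠ 0) :
      uniformCircle = uniformUnit.map hf.aemeasurable :=
    Subtype.ext (map_blockMap hN θ).symm
  have key (H : GiryNat) {n : ℕ} {A : Fin n → Set UnitAddCircle}
      (hA : ∀ i, MeasurableSet (A i)) := lintegral_prod_eq_lintegral_labelProb
    (P := H.component unitInterval uniformUnit) (Q := H.component UnitAddCircle uniformCircle)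
    (fun N θ hf hN => by rw [hblock N θ hf hN, component_map H hf]) hA
  refine ProbabilityMeasure.ext_of_forall_lintegral_prod_eq fun n A hA => ?_
  rw [key H hA, key H' hA, lintegral_lintegral_labelProb_eq_map_multCount hA, h,
    ← lintegral_lintegral_labelProb_eq_map_multCount hA]

lemma eq_of_map_multCount_eq {H H' : GiryNat}
    (h : (H.component unitInterval uniformUnit :
        Measure (ProbabilityMeasure unitInterval)).map multCount =
      (H'.component unitInterval uniformUnit :
        Measure (ProbabilityMeasure unitInterval)).map multCount) : H = H' := by
  refine ext_component fun X _ _ μ => Subtype.ext ?_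
  obtain ⟨f, hf, rfl⟩ := exists_map_uniformUnit_eq μ
  obtain ⟨g, hg, hgU⟩ := exists_map_uniformCircle_eq_uniformUnit
  change (H.component X _ : Measure (ProbabilityMeasure X)) = H'.component X _
  rw [component_map H hf, component_map H' hf, hgU, component_map H hg, component_map H' hg,
    component_uniformCircle_eq h]

end GiryNat

/-! ### Mixtures of `baseKernel`, and the bijection. -/

lemma measurable_baseKernel_right {X : Type*} [MeasurableSpace X] (μ : ProbabilityMeasure X) :
    Measurable fun φ => (baseKernel μ φ : Measure (ProbabilityMeasure X)) :=
  measurable_subtype_coe.comp (measurable_baseKernel.comp measurable_prodMk_left)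

/-- The mixture `ω >>= base`. -/
noncomputable def bindBase {X : Type*} [MeasurableSpace X] (ω : ProbabilityMeasure ElementFreeDist)
    (μ : ProbabilityMeasure X) : ProbabilityMeasure (ProbabilityMeasure X) :=
  ⟨(ω : Measure ElementFreeDist).bind fun φ => (baseKernel μ φ : Measure (ProbabilityMeasure X)),
    isProbabilityMeasure_bind (measurable_baseKernel_right μ).aemeasurable
      (.of_forall fun φ => (baseKernel μ φ).2)⟩

lemma measurable_bindBase {X : Type*} [MeasurableSpace X] (ω : ProbabilityMeasure ElementFreeDist) :
    Measurable fun μ : ProbabilityMeasure X => bindBase ω μ := by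
  refine Measurable.subtype_mk (Measure.measurable_of_measurable_coe _ fun B hB => ?_)
  simp_rw [Measure.bind_apply hB (measurable_baseKernel_right _).aemeasurable]
  have h : Measurable fun p : ProbabilityMeasure X × ElementFreeDist =>
      (baseKernel p.1 p.2 : Measure (ProbabilityMeasure X)) B :=
    (Measure.measurable_coe hB).comp (measurable_subtype_coe.comp measurable_baseKernel)
  exact h.lintegral_prod_right'

lemma bindBase_map {X Y : Type*} [MeasurableSpace X] [MeasurableSpace Y]
    (ω : ProbabilityMeasure ElementFreeDist) (μ : ProbabilityMeasure X) {f : X → Y}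
    (hf : Measurable f) :
    bindBase ω (μ.map hf.aemeasurable) =
      (bindBase ω μ).map (ProbabilityMeasure.measurable_map hf).aemeasurable := by
  refine Subtype.ext (Measure.ext fun B hB => ?_)
  have hm := ProbabilityMeasure.measurable_map hf
  change (ω : Measure ElementFreeDist).bind _ B = ((ω : Measure ElementFreeDist).bind _).map _ B
  rw [Measure.map_apply hm hB, Measure.bind_apply hB (measurable_baseKernel_right _).aemeasurable,
    Measure.bind_apply (hm hB) (measurable_baseKernel_right _).aemeasurable]
  refine lintegral_congr fun φ => ?_
  rw [← baseKernel_map μ φ hf, Measure.map_apply hm hB]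

lemma map_multCount_bindBase {X : Type*} [MeasurableSpace X] [MeasurableEq X]
    (ω : ProbabilityMeasure ElementFreeDist) (μ : ProbabilityMeasure X)
    [NullSingletonClass (μ : Measure X)] :
    (bindBase ω μ : Measure (ProbabilityMeasure X)).map multCount = ω := by
  ext D hD
  have hm : Measurable (multCount : ProbabilityMeasure X → ElementFreeDist) := measurable_multCount
  rw [Measure.map_apply hm hD, bindBase, ProbabilityMeasure.coe_mk,
    Measure.bind_apply (hm hD) (measurable_baseKernel_right _).aemeasurable,
    ← lintegral_indicator_one hD]
  refine lintegral_congr fun φ => ?_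
  rw [← Measure.map_apply hm hD, map_multCount_baseKernel, Measure.dirac_apply' _ hD]

/-- The natural transformation `ω >>= base`. -/
noncomputable def bindBaseNat (ω : ProbabilityMeasure ElementFreeDist) : GiryNat where
  app X := ⟨fun μ : ProbabilityMeasure X.1 => bindBase ω μ, measurable_bindBase ω⟩
  naturality X _ f := Subtype.ext <| funext fun μ : ProbabilityMeasure X.1 =>
    bindBase_map ω μ f.1.2

theorem mainTheorem2 :
    (∀ (X : Type) [MeasurableSpace X] [StandardBorelSpace X],
      Measurable fun p : ProbabilityMeasure X × ElementFreeDist => baseKernel p.1 p.2) ∧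
    (∀ (X : Type) [MeasurableSpace X] [StandardBorelSpace X],
      Measurable fun μ : ProbabilityMeasure X => multCount μ) ∧
    ∃ e : ProbabilityMeasure ElementFreeDist ≃ GiryNat,
      (∀ (ω : ProbabilityMeasure ElementFreeDist)
        (X : Type) [MeasurableSpace X] [StandardBorelSpace X] (μ : ProbabilityMeasure X),
        ((e ω).component X μ : Measure (ProbabilityMeasure X)) =
          (ω : Measure ElementFreeDist).bind
            fun φ => (baseKernel μ φ : Measure (ProbabilityMeasure X))) ∧
      ∀ H : GiryNat,
        (e.symm H : Measure ElementFreeDist) =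
          (H.component unitInterval uniformUnit :
            Measure (ProbabilityMeasure unitInterval)).map multCount := by
  have hleft (ω : ProbabilityMeasure ElementFreeDist) :
      ((bindBaseNat ω).component unitInterval uniformUnit :
        Measure (ProbabilityMeasure unitInterval)).map multCount = ω :=
    map_multCount_bindBase ω uniformUnit
  let β (H : GiryNat) : ProbabilityMeasure ElementFreeDist :=
    (H.component unitInterval uniformUnit).map measurable_multCount.aemeasurable
  refine ⟨fun X _ _ => measurable_baseKernel, fun X _ _ => measurable_multCount,
    ⟨bindBaseNat, β, fun ω => Subtype.ext (hleft ω), fun H => ?_⟩, fun ω X _ _ μ => rfl,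
    fun H => rfl⟩
  -- By `hleft`, `bindBaseNat (β H)` and `H` have the same image under `β`, which is injective.
  exact GiryNat.eq_of_map_multCount_eq (hleft (β H))
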